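/- Let $\sigma^x=\begin{pmatrix}0&1\\1&0\end{pmatrix}$, $\sigma^y=\begin{pmatrix}0&-\mathrm i\\ \mathrm i&0\end{pmatrix}$, $\sigma^z=\begin{pmatrix}1&0\\0&-1\end{pmatrix}$. Let $\mu$ be the random Pauli rotation in which the axis $P$ is chosen uniformly from $\{\sigma^x,\sigma^y,\sigma^z\}$: that is, $\mu=\frac13\sum_{P\in\{\sigma^x,\sigma^y,\sigma^z\}}\mu_P$, where $\mu_P$ is the law of the traceless hermitian matrix $\frac{\theta}{2}P$ for $\theta$ uniformly distributed in $(-\pi,\pi)$. For an integer $t\ge 1$ consider the following linear operators on $(\mathbb C^2)^{\otimes 2t}$: $$\mathcal C_{\mu,t}=\int \exp(\mathrm i X)^{\otimes t}\otimes\exp(-\mathrm i\bar X)^{\otimes t}\,\mathrm d\mu(X),\qquad \mathcal H_t=\int_{\mathrm{SU}(2)}U^{\otimes t}\otimes\bar U^{\otimes t}\,\mathrm dU,$$ where the bar denotes the entrywise complex conjugate and $\mathrm dU$ is the Haar probability measure on $\mathrm{SU}(2)$. Then, with $\|\cdot\|$ denoting the greatest singular value, for every integer $t\ge1$, $$\left\|\mathcal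 C_{\mu,t}-\mathcal H_t\right\|=\frac1{12}\cdot\begin{cases}4&(t=1)\\6&(t=2,3)\\7&(t\ge4).\end{cases}$$ -/

import Mathlib

open MeasureTheory
open scoped Matrix Kronecker

noncomputable section

namespace PauliRotation

/-- The real vector space of traceless hermitian `N × N` matrices, which is the real Lie algebra
`su(N)` in the convention where the factor `i` is inserted by hand. -/
def su (N : ℕ) : Submodule ℝ (Matrix (Fin N) (Fin N) ℂ) where
  carrier := {X | X.IsHermitian ∧ X.trace = 0}
  add_mem' := fun hX hY => ⟨hX.1.add hY.1, by rw [Matrix.trace_add, hX.2, hY.2, add_zero]⟩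
  zero_mem' := ⟨Matrix.isHermitian_zero, Matrix.trace_zero _ _⟩
  smul_mem' := fun c X hX =>
    ⟨by
      rw [Matrix.IsHermitian, Matrix.conjTranspose_smul, star_trivial, hX.1.eq],
     by rw [Matrix.trace_smul, hX.2, smul_zero]⟩

/-- The Borel σ-algebra on `su(N)`. -/
instance (N : ℕ) : MeasurableSpace (su N) := borel _

instance (N : ℕ) : BorelSpace (su N) := ⟨rfl⟩

/-- The group `SU(N)`, with the topology induced from the space of matrices. -/
abbrev SU (N : ℕ) : Type := Matrix.specialUnitaryGroup (Fin N) ℂ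

/-- The Borel σ-algebra on `SU(N)`. -/
instance (N : ℕ) : MeasurableSpace (SU N) := borel _

instance (N : ℕ) : BorelSpace (SU N) := ⟨rfl⟩

instance (N : ℕ) : IsTopologicalGroup (SU N) where
  continuous_inv := by
    refine Continuous.subtype_mk (f := fun U : SU N => star (U : Matrix (Fin N) (Fin N) ℂ)) ?_ _
    exact continuous_star.comp continuous_subtype_val

instance (N : ℕ) : CompactSpace (SU N) := by
  refine isCompact_iff_compactSpace.mp ?_
  have hbox : IsCompact (Set.univ.pi fun _ : Fin N => Set.univ.pi fun _ : Fin N =>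
      Metric.closedBall (0 : ℂ) 1) :=
    isCompact_univ_pi fun _ => isCompact_univ_pi fun _ => isCompact_closedBall 0 1
  refine IsCompact.of_isClosed_subset
    (s := (Set.univ.pi fun _ : Fin N => Set.univ.pi fun _ : Fin N =>
      Metric.closedBall (0 : ℂ) 1 : Set (Matrix (Fin N) (Fin N) ℂ))) hbox ?_ ?_
  · have h : (Matrix.specialUnitaryGroup (Fin N) ℂ : Set (Matrix (Fin N) (Fin N) ℂ)) =
        {A | A * star A = 1} ∩ {A | A.det = 1} := by
      ext A
      simp [Matrix.mem_specialUnitaryGroup_iff, Matrix.mem_unitaryGroup_iff]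
    rw [h]
    exact (isClosed_eq (continuous_id.mul continuous_star) continuous_const).inter
      (isClosed_eq (continuous_id.matrix_det) continuous_const)
  · intro A hA i _ j _
    simpa using entry_norm_bound_of_unitary (Matrix.mem_specialUnitaryGroup_iff.mp hA).1 i j

/-- The Haar probability measure on `SU(N)`: the Haar measure of total mass one. -/
def haarSU (N : ℕ) : Measure (SU N) := Measure.haarMeasure ⊤

/-- The `t`-fold tensor (Kronecker) power `A^{⊗ t}`, a matrix indexed by `t`-tuples of indices. -/
def tensorPow {N : ℕ} (t : ℕ) (A : Matrix (Fin N) (Fin N) ℂ) :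
    Matrix (Fin t → Fin N) (Fin t → Fin N) ℂ :=
  Matrix.of fun r s => ∏ j, A (r j) (s j)

/-- The Hilbert space `(ℂ^N)^{⊗ 2t}`, written in coordinates as `(ℂ^N)^{⊗ t} ⊗ (ℂ^N)^{⊗ t}`. -/
abbrev TensorSpace (N t : ℕ) : Type :=
  EuclideanSpace ℂ ((Fin t → Fin N) × (Fin t → Fin N))

/-- The operator `A^{⊗ t} ⊗ B^{⊗ t}` on `(ℂ^N)^{⊗ 2t}`. The norm on the space of operators
is the operator norm, that is, the greatest singular value. -/
def tensorOp {N : ℕ} (t : ℕ) (A B : Matrix (Fin N) (Fin N) ℂ) :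
    TensorSpace N t →L[ℂ] TensorSpace N t :=
  Matrix.toEuclideanCLM (𝕜 := ℂ) (tensorPow t A ⊗ₖ tensorPow t B)

/-- The entrywise complex conjugate of a matrix. -/
def conjMat {N : ℕ} (A : Matrix (Fin N) (Fin N) ℂ) : Matrix (Fin N) (Fin N) ℂ :=
  A.map (starRingEnd ℂ)

/-- `C_{μ,t}`, the average of `exp(iX)^{⊗ t} ⊗ exp(-i X̄)^{⊗ t}` over `X` distributed
according to the measure `μ` on `su(N)`. -/
def momentOp {N : ℕ} (μ : Measure (su N)) (t : ℕ) : TensorSpace N t →L[ℂ] TensorSpace N t :=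
  ∫ X, tensorOp t (NormedSpace.exp (Complex.I • (X : Matrix (Fin N) (Fin N) ℂ)))
    (NormedSpace.exp (-(Complex.I • conjMat (X : Matrix (Fin N) (Fin N) ℂ)))) ∂μ

/-- `H_t`, the average of `U^{⊗ t} ⊗ Ū^{⊗ t}` over Haar random `U` in `SU(N)`. -/
def haarMomentOp (N t : ℕ) : TensorSpace N t →L[ℂ] TensorSpace N t :=
  ∫ U : SU N, tensorOp t (U : Matrix (Fin N) (Fin N) ℂ)
    (conjMat (U : Matrix (Fin N) (Fin N) ℂ)) ∂(haarSU N)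

/-- The uniform probability measure on the interval `(-π, π)`. -/
def uniformAngle : Measure ℝ := ProbabilityTheory.cond volume (Set.Ioo (-Real.pi) Real.pi)

/-- The random rotation by `P`: the law of `(θ / 2) P` for `θ` uniform in `(-π, π)`. -/
def rotationBy {N : ℕ} (P : su N) : Measure (su N) :=
  uniformAngle.map fun θ : ℝ => (θ / 2) • P

/-- The mixture `∑ₖ pₖ μ_{Pₖ}` of the random rotations by `Pₖ`, with weights `pₖ`. -/
def randomRotation {N : ℕ} {κ : Type} [Fintype κ] (P : κ → su N) (p : PMF κ) : Measure (su N) :=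
  ∑ k, p k • rotationBy (P k)

/-- The Pauli matrix `σ^x`. -/
def sigmaX : su 2 :=
  ⟨!![0, 1; 1, 0], by
    ext i j; fin_cases i <;> fin_cases j <;> simp, by simp [Matrix.trace_fin_two]⟩

/-- The Pauli matrix `σ^y`. -/
def sigmaY : su 2 :=
  ⟨!![0, -Complex.I; Complex.I, 0], by
    ext i j; fin_cases i <;> fin_cases j <;> simp, by simp [Matrix.trace_fin_two]⟩

/-- The Pauli matrix `σ^z`. -/
def sigmaZ : su 2 :=
  ⟨!![1, 0; 0, -1], by
    ext i j; fin_cases i <;> fin_cases j <;> simp, by simp [Matrix.trace_fin_two]⟩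

end PauliRotation

end

noncomputable section

namespace PauliRotation

open scoped InnerProductSpace

/-! The operators U^{⊗t} ⊗ Ū^{⊗t} form a unitary representation of SU(2) with integral spins 0, …,
t, all of which occur. Averaging over a full turn about one axis gives the orthogonal projection
onto the vectors of weight zero for that axis, and Haar averaging gives the projection onto the
invariant vectors. Hence the difference vanishes in spin 0, and in spin ℓ ≥ 1 it is one third of a
sum of three projections.

That sum is T T* for the map T : (x, y, z) ↦ x + y + z on triples of vectors fixed by the respective
axes, so its norm is that of the Gram operator T* T. In an irreducible representation of spin ℓ this
is a 3 × 3 matrix with ones on the diagonal and the Legendre value P_ℓ(0) elsewhere: 0 for odd ℓ,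
-1/2 for ℓ = 2, 3/8 for ℓ = 4, and less than 3/8 in modulus for larger ℓ. The top eigenvalues are 1
for odd ℓ, 3/2 for ℓ = 2, 7/4 for ℓ = 4, and below 7/4 afterwards. Division by three gives 4/12,
6/12, 7/12, with jumps at t = 2 and t = 4.

No decomposition into irreducibles is used. Everything happens in an eigenspace of the Casimir
operator for a real number c, and the admissible values of c come out of positivity along the ladder
of weights (`zero_weight_cases`). The passage between T T* and T* T is `norm_dev_le` and
`le_norm_dev`; `momentOp_eq_avg` and `haarMomentOp_eq_invProj` identify the two averages with the
abstract operators. -/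

/-- A representation of `su(2)` on a Hilbert space with integral weights of modulus at most `t`,
given by the weight operator `Jz`, the ladder operators `Jp` and `Jm`, the projections `Q m`
onto the weight spaces, and a rotation `R` which permutes the three axes cyclically. -/
structure SpinRep (E : Type*) [NormedAddCommGroup E] [InnerProductSpace ℂ E] (t : ℕ) where
  Jz : E →L[ℂ] E
  Jp : E →L[ℂ] E
  Jm : E →L[ℂ] E
  Q : ℤ → E →L[ℂ] E
  R : E ≃ₗᵢ[ℂ] E
  inner_Jz : ∀ u v, ⟪Jz u, v⟫_ℂ = ⟪u, Jz v⟫_ℂ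
  inner_Jp : ∀ u v, ⟪Jp u, v⟫_ℂ = ⟪u, Jm v⟫_ℂ
  Jz_Jp : ∀ v, Jz (Jp v) = Jp (Jz v) + Jp v
  Jz_Jm : ∀ v, Jz (Jm v) = Jm (Jz v) - Jm v
  Jp_Jm : ∀ v, Jp (Jm v) = Jm (Jp v) + (2 : ℂ) • Jz v
  Jz_Q : ∀ m v, Jz (Q m v) = (m : ℂ) • Q m v
  Q_of_eq : ∀ (m : ℤ) v, Jz v = (m : ℂ) • v → Q m v = v
  Q_of_ne : ∀ (m n : ℤ) v, Jz v = (m : ℂ) • v → n ≠ m → Q n v = 0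
  sum_Q : ∀ v, ∑ m ∈ Finset.Icc (-(t : ℤ)) t, Q m v = v
  Q_of_lt : ∀ m v, (t : ℤ) < |m| → Q m v = 0
  R_Jx : ∀ v, R (Jp v + Jm v) = -Complex.I • (Jp (R v) - Jm (R v))
  R_Jy : ∀ v, R (Jp v - Jm v) = (2 * Complex.I) • Jz (R v)
  R_Jz : ∀ v, (2 : ℂ) • R (Jz v) = Jp (R v) + Jm (R v)

/-! ### Weights, ladder operators and the Casimir operator. -/

namespace SpinRep

variable {E : Type*} [NormedAddCommGroup E] [InnerProductSpace ℂ E] {t : ℕ} (S : SpinRep E t)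

lemma inner_Jm (u v : E) : ⟪S.Jm u, v⟫_ℂ = ⟪u, S.Jp v⟫_ℂ := by
  rw [← inner_conj_symm, ← S.inner_Jp, inner_conj_symm]

/-- The Casimir operator. -/
def cas : E →L[ℂ] E := S.Jm ∘L S.Jp + S.Jz ∘L S.Jz + S.Jz

lemma cas_apply (v : E) : S.cas v = S.Jm (S.Jp v) + S.Jz (S.Jz v) + S.Jz v := rfl

lemma inner_cas (u v : E) : ⟪S.cas u, v⟫_ℂ = ⟪u, S.cas v⟫_ℂ := by
  simp only [cas_apply, inner_add_left, inner_add_right, inner_Jm, S.inner_Jp, S.inner_Jz]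

lemma cas_Jz (v : E) : S.cas (S.Jz v) = S.Jz (S.cas v) := by
  simp only [cas_apply, map_add, S.Jz_Jm, S.Jz_Jp]
  abel

lemma cas_Jp (v : E) : S.cas (S.Jp v) = S.Jp (S.cas v) := by
  simp only [cas_apply, map_add, S.Jz_Jp, S.Jp_Jm]
  module

lemma cas_Jm (v : E) : S.cas (S.Jm v) = S.Jm (S.cas v) := by
  simp only [cas_apply, map_add, S.Jz_Jm, S.Jp_Jm, map_sub, map_smul]
  module

/-- The vectors of weight `m` in the eigenspace of the Casimir operator for `c`. -/
def IsWeight (c : ℝ) (m : ℤ) (v : E) : Prop :=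
  S.Jz v = (m : ℂ) • v ∧ S.cas v = (c : ℂ) • v

variable {S}

lemma IsWeight.Jp {c : ℝ} {m : ℤ} {v : E} (h : S.IsWeight c m v) :
    S.IsWeight c (m + 1) (S.Jp v) := by
  refine ⟨?_, by rw [cas_Jp, h.2, map_smul]⟩
  rw [S.Jz_Jp, h.1, map_smul]; push_cast; module

lemma IsWeight.Jm {c : ℝ} {m : ℤ} {v : E} (h : S.IsWeight c m v) :
    S.IsWeight c (m - 1) (S.Jm v) := by
  refine ⟨?_, by rw [cas_Jm, h.2, map_smul]⟩
  rw [S.Jz_Jm, h.1, map_smul]; push_cast; module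

lemma IsWeight.smul {c : ℝ} {m : ℤ} {v : E} (h : S.IsWeight c m v) (a : ℂ) :
    S.IsWeight c m (a • v) := by
  constructor
  · rw [map_smul, h.1, smul_comm]
  · rw [map_smul, h.2, smul_comm]

lemma IsWeight.Jm_Jp {c : ℝ} {m : ℤ} {v : E} (h : S.IsWeight c m v) :
    S.Jm (S.Jp v) = ((c - m * (m + 1) : ℝ) : ℂ) • v := by
  have h2 := h.2
  rw [cas_apply, h.1, map_smul, h.1] at h2
  rw [← eq_sub_iff_add_eq, ← eq_sub_iff_add_eq] at h2
  rw [h2]; push_cast; module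

lemma IsWeight.Jp_Jm {c : ℝ} {m : ℤ} {v : E} (h : S.IsWeight c m v) :
    S.Jp (S.Jm v) = ((c - m * (m - 1) : ℝ) : ℂ) • v := by
  rw [S.Jp_Jm, h.Jm_Jp, h.1]; push_cast; module

lemma IsWeight.norm_Jp {c : ℝ} {m : ℤ} {v : E} (h : S.IsWeight c m v) :
    ‖S.Jp v‖ ^ 2 = (c - m * (m + 1)) * ‖v‖ ^ 2 := by
  have : ((‖S.Jp v‖ ^ 2 : ℝ) : ℂ) = ((c - m * (m + 1)) * ‖v‖ ^ 2 : ℝ) := by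
    push_cast
    rw [← Complex.coe_algebraMap, ← inner_self_eq_norm_sq_to_K (𝕜 := ℂ), S.inner_Jp, h.Jm_Jp,
      inner_smul_right, inner_self_eq_norm_sq_to_K (𝕜 := ℂ)]
    push_cast; rfl
  exact_mod_cast this

lemma IsWeight.norm_Jm {c : ℝ} {m : ℤ} {v : E} (h : S.IsWeight c m v) :
    ‖S.Jm v‖ ^ 2 = (c - m * (m - 1)) * ‖v‖ ^ 2 := by
  have : ((‖S.Jm v‖ ^ 2 : ℝ) : ℂ) = ((c - m * (m - 1)) * ‖v‖ ^ 2 : ℝ) := by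
    push_cast
    rw [← Complex.coe_algebraMap, ← inner_self_eq_norm_sq_to_K (𝕜 := ℂ), inner_Jm, h.Jp_Jm,
      inner_smul_right, inner_self_eq_norm_sq_to_K (𝕜 := ℂ)]
    push_cast; rfl
  exact_mod_cast this

variable (S)

lemma inner_eq_zero_of_ne {m n : ℤ} {u v : E} (hu : S.Jz u = (m : ℂ) • u)
    (hv : S.Jz v = (n : ℂ) • v) (h : m ≠ n) : ⟪u, v⟫_ℂ = 0 := by
  have h1 := S.inner_Jz u v
  rw [hu, hv, inner_smul_left, inner_smul_right, map_intCast] at h1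
  have h2 : (m : ℂ) - n ≠ 0 := sub_ne_zero.2 (by exact_mod_cast h)
  have h3 : ((m : ℂ) - n) * ⟪u, v⟫_ℂ = 0 := by rw [sub_mul, h1, sub_self]
  exact (mul_eq_zero.1 h3).resolve_left h2

lemma inner_Q_of_ne {m n : ℤ} (u v : E) (h : m ≠ n) : ⟪S.Q m u, S.Q n v⟫_ℂ = 0 :=
  S.inner_eq_zero_of_ne (S.Jz_Q m u) (S.Jz_Q n v) h

/-- Adding an arbitrary `m` to the summation range is harmless, since its component vanishes when
out of range, and lets later expansions single out that term. -/
lemma eq_sum_Q (m : ℤ) (v : E) : ∃ T : Finset ℤ, m ∈ T ∧ ∑ n ∈ T, S.Q n v = v := by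
  refine ⟨insert m (Finset.Icc (-(t : ℤ)) t), Finset.mem_insert_self _ _, ?_⟩
  by_cases hm : m ∈ Finset.Icc (-(t : ℤ)) t
  · rw [Finset.insert_eq_of_mem hm, S.sum_Q]
  · rw [Finset.sum_insert hm, S.sum_Q, S.Q_of_lt, zero_add]
    rw [Finset.mem_Icc, ← abs_le] at hm
    exact not_le.1 hm

lemma inner_Q_left (m : ℤ) (u v : E) : ⟪S.Q m u, v⟫_ℂ = ⟪S.Q m u, S.Q m v⟫_ℂ := by
  obtain ⟨T, hm, hT⟩ := S.eq_sum_Q m v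
  nth_rw 1 [← hT]
  rw [inner_sum]
  exact Finset.sum_eq_single_of_mem m hm fun n _ hn => S.inner_Q_of_ne u v (Ne.symm hn)

lemma inner_Q (m : ℤ) (u v : E) : ⟪S.Q m u, v⟫_ℂ = ⟪u, S.Q m v⟫_ℂ := by
  rw [inner_Q_left, ← inner_conj_symm u, inner_Q_left S m v u, inner_conj_symm]

/-- An operator shifting weights by `k` carries weight components to weight components; used with
shift 0, 1 and -1. -/
lemma Q_eq_of_map {A : E →L[ℂ] E} {k : ℤ}
    (hA : ∀ (m : ℤ) v, S.Jz v = (m : ℂ) • v → S.Jz (A v) = ((m + k : ℤ) : ℂ) • A v)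
    (m : ℤ) (v : E) : S.Q (m + k) (A v) = A (S.Q m v) := by
  obtain ⟨T, hm, hT⟩ := S.eq_sum_Q m v
  nth_rw 1 [← hT]
  rw [map_sum, map_sum, Finset.sum_eq_single_of_mem m hm]
  · exact S.Q_of_eq _ _ (hA m _ (S.Jz_Q m v))
  · intro n _ hn
    exact S.Q_of_ne _ _ _ (hA n _ (S.Jz_Q n v)) (by omega)

lemma Q_cas (m : ℤ) (v : E) : S.Q m (S.cas v) = S.cas (S.Q m v) := by
  have := S.Q_eq_of_map (A := S.cas) (k := 0) (fun m v h => by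
    rw [← cas_Jz, h, map_smul, add_zero]) m v
  rwa [add_zero] at this

lemma Q_Jp (m : ℤ) (v : E) : S.Q (m + 1) (S.Jp v) = S.Jp (S.Q m v) :=
  S.Q_eq_of_map (fun m v h => by rw [S.Jz_Jp, h, map_smul]; push_cast; module) m v

lemma Q_Jm (m : ℤ) (v : E) : S.Q (m - 1) (S.Jm v) = S.Jm (S.Q m v) :=
  S.Q_eq_of_map (A := S.Jm) (k := -1)
    (fun m v h => by rw [S.Jz_Jm, h, map_smul]; push_cast; module) m v

lemma isWeight_Q {c : ℝ} {v : E} (h : S.cas v = (c : ℂ) • v) (m : ℤ) :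
    S.IsWeight c m (S.Q m v) :=
  ⟨S.Jz_Q m v, by rw [← Q_cas, h, map_smul]⟩

lemma norm_sq_sum_Q (v : E) (T : Finset ℤ) :
    ‖∑ m ∈ T, S.Q m v‖ ^ 2 = ∑ m ∈ T, ‖S.Q m v‖ ^ 2 := by
  induction T using Finset.induction_on with
  | empty => simp
  | insert m T hm ih =>
    rw [Finset.sum_insert hm, Finset.sum_insert hm, ← ih, sq, sq, sq,
      norm_add_sq_eq_norm_sq_add_norm_sq_of_inner_eq_zero (𝕜 := ℂ)]
    rw [inner_sum]
    exact Finset.sum_eq_zero fun n hn => S.inner_Q_of_ne _ _ (by rintro rfl; exact hm hn)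

lemma norm_sq_eq_sum (v : E) (T : Finset ℤ) (hT : ∀ m ∉ T, S.Q m v = 0) :
    ‖v‖ ^ 2 = ∑ m ∈ T, ‖S.Q m v‖ ^ 2 := by
  rw [← norm_sq_sum_Q]
  congr 2
  conv_lhs => rw [← S.sum_Q v]
  refine (Finset.sum_subset Finset.subset_union_left fun m _ hm => ?_).trans
    (Finset.sum_subset (Finset.subset_union_right (s₁ := Finset.Icc (-(t : ℤ)) t))
      fun m _ hm => hT m hm).symm
  rw [Finset.mem_Icc, ← abs_le] at hm
  exact S.Q_of_lt m v (not_le.1 hm)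

lemma sum_le_norm_sq (v : E) (T : Finset ℤ) : ∑ m ∈ T, ‖S.Q m v‖ ^ 2 ≤ ‖v‖ ^ 2 := by
  rw [S.norm_sq_eq_sum v (Finset.Icc (-(t : ℤ)) t ∪ T)]
  · exact Finset.sum_le_sum_of_subset_of_nonneg Finset.subset_union_right fun _ _ _ => sq_nonneg _
  · intro m hm
    rw [Finset.mem_union, not_or, Finset.mem_Icc, ← abs_le] at hm
    exact S.Q_of_lt m v (not_le.1 hm.1)

lemma Q_zero_eq_self_iff {v : E} : S.Q 0 v = v ↔ S.Jz v = 0 := by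
  constructor
  · intro h
    have := S.Jz_Q 0 v
    rwa [h, Int.cast_zero, zero_smul] at this
  · intro h
    exact S.Q_of_eq 0 v (by rw [h, Int.cast_zero, zero_smul])

lemma Q_Q_self (m : ℤ) (v : E) : S.Q m (S.Q m v) = S.Q m v := S.Q_of_eq m _ (S.Jz_Q m v)

/-- The component of weight `m` of the equation links weight `m - 1` of `u` to weight `m + 1` of
`v`, and the Casimir eigenvalue gives the norms on both sides. For `u = v` this is the two-step
recursion for a vector fixed by the first axis (`e = -1`) or the second (`e = 1`). -/
lemma norm_Q_recursion {c : ℝ} {e : ℂ} (he : ‖e‖ = 1) {u v : E} (hu : S.cas u = (c : ℂ) • u)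
    (hv : S.cas v = (c : ℂ) • v) (h : S.Jp u = e • S.Jm v) (m : ℤ) :
    (c - (m - 1) * m) * ‖S.Q (m - 1) u‖ ^ 2 = (c - (m + 1) * m) * ‖S.Q (m + 1) v‖ ^ 2 := by
  have h1 : S.Jp (S.Q (m - 1) u) = e • S.Jm (S.Q (m + 1) v) := by
    rw [← Q_Jp, ← Q_Jm, sub_add_cancel, add_sub_cancel_right, h, map_smul]
  have h2 := (S.isWeight_Q hu (m - 1)).norm_Jp
  have h3 := (S.isWeight_Q hv (m + 1)).norm_Jm
  rw [h1, norm_smul, he, one_mul, h3] at h2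
  push_cast at h2
  rw [sub_add_cancel, add_sub_cancel_right] at h2
  exact h2.symm

/-- A raised vector has nonnegative squared norm. This is what restricts `c`, which is never assumed
to be of the form ℓ(ℓ + 1). -/
lemma norm_Q_bound {c : ℝ} {v : E} (hv : S.cas v = (c : ℂ) • v) (m : ℤ) :
    0 ≤ (c - m * (m + 1)) * ‖S.Q m v‖ ^ 2 := by
  rw [← (S.isWeight_Q hv m).norm_Jp]
  positivity

lemma norm_Q_bound' {c : ℝ} {v : E} (hv : S.cas v = (c : ℂ) • v) (m : ℤ) :
    0 ≤ (c - m * (m - 1)) * ‖S.Q m v‖ ^ 2 := by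
  rw [← (S.isWeight_Q hv m).norm_Jm]
  positivity

/-! ### Zero-weight components of vectors fixed by another axis. -/

lemma ladder_step {c k l a b : ℝ} (ha : 0 < a) (hk : k < c) (hb : 0 ≤ b)
    (h : (c - k) * a = (c - l) * b) : l < c ∧ 0 < b := by
  have h1 : 0 < (c - l) * b := h ▸ mul_pos (sub_pos.2 hk) ha
  have h2 : 0 < b := hb.lt_of_ne (by rintro rfl; simp at h1)
  exact ⟨by nlinarith, h2⟩

lemma ladder_bound {c k l a b : ℝ} (ha : 0 < a) (hk : k < c) (hkl : k ≤ l) (hb : 0 ≤ b)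
    (h : (c - k) * a = (c - l) * b) : a ≤ b := by
  have := (ladder_step ha hk hb h).1
  nlinarith

/-- The weight vectors of a vector in the kernel of `Jp - e • Jm`. -/
lemma zero_weight_cases {c : ℝ} {e : ℂ} (he : ‖e‖ = 1) {x : E} (hx : S.cas x = (c : ℂ) • x)
    (h : S.Jp x = e • S.Jm x) (hc : c ≠ 0) :
    S.Q 0 x = 0 ∨ (c = 6 ∧ 2 ≤ t ∧ 4 * ‖S.Q 0 x‖ ^ 2 ≤ ‖x‖ ^ 2) ∨
      (20 ≤ c ∧ 4 ≤ t ∧ 64 * ‖S.Q 0 x‖ ^ 2 ≤ 9 * ‖x‖ ^ 2) := by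
  by_cases h0 : S.Q 0 x = 0
  · exact Or.inl h0
  right
  set a : ℤ → ℝ := fun m => ‖S.Q m x‖ ^ 2 with ha
  have hpos : ∀ m, 0 ≤ a m := fun m => sq_nonneg _
  have ht : ∀ m, 0 < a m → |m| ≤ t := by
    intro m hm
    by_contra hlt
    simp [ha, S.Q_of_lt m x (not_le.1 hlt)] at hm
  have h00 : 0 < a 0 := by positivity
  have key := fun m => S.norm_Q_recursion he hx hx h m
  have b0 : 0 ≤ (c - 0) * a 0 := by
    convert S.norm_Q_bound hx 0 using 2; norm_num
  have b2 : 0 ≤ (c - 6) * a 2 := by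
    convert S.norm_Q_bound hx 2 using 2; norm_num
  have b4 : 0 ≤ (c - 20) * a 4 := by
    convert S.norm_Q_bound hx 4 using 2; norm_num
  have b6 : 0 ≤ (c - 42) * a 6 := by
    convert S.norm_Q_bound hx 6 using 2; norm_num
  have k1 : (c - 0) * a 0 = (c - 2) * a 2 := by
    have := key 1; norm_num at this; simpa [ha] using this
  have k3 : (c - 6) * a 2 = (c - 12) * a 4 := by
    have := key 3; norm_num at this; exact this
  have k5 : (c - 20) * a 4 = (c - 30) * a 6 := by
    have := key 5; norm_num at this; exact this
  have k7 : (c - 42) * a 6 = (c - 56) * a 8 := by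
    have := key 7; norm_num at this; exact this
  have k1' : (c - 0) * a 0 = (c - 2) * a (-2) := by
    have := key (-1); norm_num at this; simpa [ha] using this.symm
  have k3' : (c - 6) * a (-2) = (c - 12) * a (-4) := by
    have := key (-3); norm_num at this; exact this.symm
  have k5' : (c - 20) * a (-4) = (c - 30) * a (-6) := by
    have := key (-5); norm_num at this; exact this.symm
  have k7' : (c - 42) * a (-6) = (c - 56) * a (-8) := by
    have := key (-7); norm_num at this; exact this.symm
  have hsum : a 0 + a 2 + a (-2) + a 4 + a (-4) + a 6 + a (-6) + a 8 + a (-8) ≤ ‖x‖ ^ 2 := by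
    have := S.sum_le_norm_sq x {0, 2, -2, 4, -4, 6, -6, 8, -8}
    refine le_trans (le_of_eq ?_) this
    rw [Finset.sum_insert (by decide), Finset.sum_insert (by decide),
      Finset.sum_insert (by decide), Finset.sum_insert (by decide),
      Finset.sum_insert (by decide), Finset.sum_insert (by decide),
      Finset.sum_insert (by decide), Finset.sum_insert (by decide), Finset.sum_singleton]
    ring
  -- A nonzero weight-0 component forces nonzero components of weights ±2, and then `b2` gives c ≥
  -- 6; the ladder either ends there (c = 6) or goes on in the same way.
  have c0 : 0 < c := lt_of_le_of_ne (by nlinarith) (Ne.symm hc)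
  obtain ⟨c2, p2⟩ := ladder_step h00 c0 (hpos 2) k1
  obtain ⟨-, p2'⟩ := ladder_step h00 c0 (hpos (-2)) k1'
  have c6 : 6 ≤ c := by nlinarith
  -- For c = 6 the components of weight ±2 are 3/2 of `a 0`, so the total is at least 4 `a 0`.
  rcases c6.eq_or_lt with rfl | c6
  · left
    refine ⟨rfl, by simpa using ht 2 p2, ?_⟩
    have := hpos 4; have := hpos (-4); have := hpos 6; have := hpos (-6)
    have := hpos 8; have := hpos (-8)
    change 4 * a 0 ≤ _
    linarith
  right
  obtain ⟨c12, p4⟩ := ladder_step p2 c6 (hpos 4) k3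
  obtain ⟨-, p4'⟩ := ladder_step p2' c6 (hpos (-4)) k3'
  have c20 : 20 ≤ c := by nlinarith
  refine ⟨c20, by simpa using ht 4 p4, ?_⟩
  change 64 * a 0 ≤ _
  -- For c = 20 the ratios to `a 0` are 10/9 at ±2 and 35/18 at ±4, with total 64/9.
  rcases c20.eq_or_lt with rfl | c20
  · have := hpos 6; have := hpos (-6); have := hpos 8; have := hpos (-8)
    linarith
  obtain ⟨c30, p6⟩ := ladder_step p4 c20 (hpos 6) k5
  obtain ⟨-, p6'⟩ := ladder_step p4' c20 (hpos (-6)) k5'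
  have c42 : 42 ≤ c := by nlinarith
  -- For c = 42 the same computation up to weight 6 gives 256/25 > 64/9.
  rcases c42.eq_or_lt with rfl | c42
  · have := hpos 8; have := hpos (-8)
    linarith
  -- For c > 42 the components do not decrease outwards up to weight 8, so nine of them are at least
  -- `a 0`, and 9 > 64/9.
  have l1 := ladder_bound h00 c0 (by norm_num) (hpos 2) k1
  have l2 := ladder_bound p2 c6 (by norm_num) (hpos 4) k3
  have l3 := ladder_bound p4 c20 (by norm_num) (hpos 6) k5
  have l4 := ladder_bound p6 c42 (by norm_num) (hpos 8) k7
  have l1' := ladder_bound h00 c0 (by norm_num) (hpos (-2)) k1'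
  have l2' := ladder_bound p2' c6 (by norm_num) (hpos (-4)) k3'
  have l3' := ladder_bound p4' c20 (by norm_num) (hpos (-6)) k5'
  have l4' := ladder_bound p6' c42 (by norm_num) (hpos (-8)) k7'
  linarith

/-- The sum of three vectors which are fixed by the three axes, in spin two. -/
lemma norm_add_sq_le_of_cas_six {x y z : E} (hx : S.cas x = ((6 : ℝ) : ℂ) • x)
    (hy : S.cas y = ((6 : ℝ) : ℂ) • y) (hxx : S.Jp x + S.Jm x = 0) (hyy : S.Jp y - S.Jm y = 0)
    (hz : S.Jz z = 0) (h4x : 4 * ‖S.Q 0 x‖ ^ 2 ≤ ‖x‖ ^ 2) (h4y : 4 * ‖S.Q 0 y‖ ^ 2 ≤ ‖y‖ ^ 2) :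
    ‖x + y + z‖ ^ 2 ≤ 3 / 2 * (‖x‖ ^ 2 + ‖y‖ ^ 2 + ‖z‖ ^ 2) := by
  have hz0 : S.Q 0 z = z := S.Q_zero_eq_self_iff.2 hz
  have hzn : ∀ m ≠ 0, S.Q m z = 0 := fun m hm => S.Q_of_ne 0 m z (by simpa using hz) hm
  have hpx : S.Jp x = -S.Jm x := eq_neg_of_add_eq_zero_left hxx
  have hpy : S.Jp y = S.Jm y := sub_eq_zero.1 hyy
  -- Bounding inner products by their moduli would only give 1 + 2 · 1/2 = 2, so signs matter here.
  -- The ladder relation exchanges x + y and x - y, which ties the weights ±2 of the sum to weight 0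
  -- of the difference.
  have hs : S.cas (x + y) = ((6 : ℝ) : ℂ) • (x + y) := by rw [map_add, hx, hy, smul_add]
  have hd : S.cas (x - y) = ((6 : ℝ) : ℂ) • (x - y) := by rw [map_sub, hx, hy, smul_sub]
  have hsd : S.Jp (x + y) = (-1 : ℂ) • S.Jm (x - y) := by
    rw [map_add, map_sub, hpx, hpy]; module
  have hds : S.Jp (x - y) = (-1 : ℂ) • S.Jm (x + y) := by
    rw [map_add, map_sub, hpx, hpy]; module
  have k1 := S.norm_Q_recursion (by simp) hs hd hsd
  have k2 := S.norm_Q_recursion (by simp) hd hs hds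
  -- These give 4‖Q_{±2}(x + y)‖² = 6‖Q_0(x - y)‖² and the vanishing of x + y in the weights ±1.
  have e2 := k2 1
  have e2' := k1 (-1)
  have f1 := k1 2
  have f1' := k2 (-2)
  norm_num at e2 e2' f1 f1'
  have hT : ∀ m ∉ ({0, 2, -2} : Finset ℤ), S.Q m (x + y + z) = 0 := by
    intro m hm
    simp only [Finset.mem_insert, Finset.mem_singleton, not_or] at hm
    rw [map_add, hzn m hm.1, add_zero]
    rcases eq_or_ne m 1 with rfl | h1
    · rw [map_add, f1]
    rcases eq_or_ne m (-1) with rfl | h1'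
    · rw [map_add, f1']
    have b1 := S.norm_Q_bound hs m
    have b2 := S.norm_Q_bound' hs m
    by_contra hne
    have hp : 0 < ‖S.Q m (x + y)‖ ^ 2 := by positivity
    have b1 := nonneg_of_mul_nonneg_left b1 hp
    have b2 := nonneg_of_mul_nonneg_left b2 hp
    have b1' : m * (m + 1) ≤ 6 := by exact_mod_cast sub_nonneg.1 b1
    have b2' : m * (m - 1) ≤ 6 := by exact_mod_cast sub_nonneg.1 b2
    have : m < 3 := by nlinarith
    have : -3 < m := by nlinarith
    omega
  rw [S.norm_sq_eq_sum _ _ hT, Finset.sum_insert (by decide), Finset.sum_insert (by decide),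
    Finset.sum_singleton, map_add _ (x + y) z, map_add _ (x + y) z, map_add _ (x + y) z,
    hzn 2 (by norm_num), hzn (-2) (by norm_num), add_zero, add_zero, hz0]
  have hp := parallelogram_law_with_norm ℂ (S.Q 0 x) (S.Q 0 y)
  have htri := norm_add_le (S.Q 0 x + S.Q 0 y) z
  rw [map_add _ x y, map_add _ x y, map_add _ x y]
  -- With p = ‖Q_0(x + y)‖ one has (p + ‖z‖)² ≤ 3p² + (3/2)‖z‖². The weights ±2 add 3‖Q_0(x - y)‖²,
  -- and the parallelogram law makes 6(‖Q_0 x‖² + ‖Q_0 y‖²) of the two terms with factor 3.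
  nlinarith [sq_nonneg (2 * ‖S.Q 0 x + S.Q 0 y‖ - ‖z‖), norm_nonneg (S.Q 0 x + S.Q 0 y + z)]

end SpinRep

/-! ### The norm of the deviation through triples of fixed vectors. -/

lemma exists_hasEigenvalue_norm_eq {E : Type*} [NormedAddCommGroup E] [InnerProductSpace ℂ E]
    [FiniteDimensional ℂ E] [Nontrivial E] {K : E →L[ℂ] E}
    (hK : (K : E →ₗ[ℂ] E).IsSymmetric) :
    ∃ k : ℂ, Module.End.HasEigenvalue (K : E →ₗ[ℂ] E) k ∧ ‖k‖ = ‖K‖ := by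
  have : CompleteSpace E := FiniteDimensional.complete ℂ E
  obtain ⟨k, hk, hk'⟩ := spectrum.exists_nnnorm_eq_spectralRadius K
  rw [K.spectralRadius_eq_nnnorm hK.isSelfAdjoint] at hk'
  rw [ContinuousLinearMap.spectrum_eq] at hk
  exact ⟨k, Module.End.hasEigenvalue_iff_mem_spectrum.2 hk, congrArg NNReal.toReal
    (ENNReal.coe_injective hk')⟩

namespace SpinRep

variable {E : Type*} [NormedAddCommGroup E] [InnerProductSpace ℂ E] {t : ℕ} (S : SpinRep E t)

/-- The projection onto the vectors fixed by the rotations about the first axis. -/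
def projX : E →L[ℂ] E := S.R.toContinuousLinearEquiv ∘L S.Q 0 ∘L S.R.symm.toContinuousLinearEquiv

/-- The projection onto the vectors fixed by the rotations about the second axis. -/
def projY : E →L[ℂ] E := S.R.symm.toContinuousLinearEquiv ∘L S.Q 0 ∘L S.R.toContinuousLinearEquiv

lemma projX_apply (v : E) : S.projX v = S.R (S.Q 0 (S.R.symm v)) := rfl

lemma projY_apply (v : E) : S.projY v = S.R.symm (S.Q 0 (S.R v)) := rfl

lemma Jz_Q_zero (v : E) : S.Jz (S.Q 0 v) = 0 := by
  rw [S.Jz_Q, Int.cast_zero, zero_smul]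

lemma R_of_Jz {v : E} (h : S.Jz v = 0) : S.Jp (S.R v) + S.Jm (S.R v) = 0 := by
  rw [← S.R_Jz, h, map_zero, smul_zero]

lemma R_of_Jx {v : E} (h : S.Jp v + S.Jm v = 0) : S.Jp (S.R v) - S.Jm (S.R v) = 0 := by
  have := S.R_Jx v
  rw [h, map_zero, eq_comm, smul_eq_zero] at this
  exact this.resolve_left (by simp)

lemma R_of_Jy {v : E} (h : S.Jp v - S.Jm v = 0) : S.Jz (S.R v) = 0 := by
  have := S.R_Jy v
  rw [h, map_zero, eq_comm, smul_eq_zero] at this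
  exact this.resolve_left (by simp)

lemma Jx_projX (v : E) : S.Jp (S.projX v) + S.Jm (S.projX v) = 0 :=
  S.R_of_Jz (S.Jz_Q_zero _)

lemma Jy_projY (v : E) : S.Jp (S.projY v) - S.Jm (S.projY v) = 0 := by
  have h := S.R_Jy (S.projY v)
  rw [projY_apply, S.R.apply_symm_apply, Jz_Q_zero, smul_zero] at h
  exact S.R.map_eq_zero_iff.1 h

lemma projX_eq_self {v : E} (h : S.Jp v + S.Jm v = 0) : S.projX v = v := by
  have h1 := S.R_Jz (S.R.symm v)
  rw [S.R.apply_symm_apply, h, smul_eq_zero] at h1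
  have h2 := S.R.map_eq_zero_iff.1 (h1.resolve_left two_ne_zero)
  rw [projX_apply, S.Q_zero_eq_self_iff.2 h2, S.R.apply_symm_apply]

lemma projY_eq_self {v : E} (h : S.Jp v - S.Jm v = 0) : S.projY v = v := by
  rw [projY_apply, S.Q_zero_eq_self_iff.2 (S.R_of_Jy h), S.R.symm_apply_apply]

/-- The Casimir operator is J_x² + J_y² + J_z², and the rotation permutes the squares. Here `key` is
four times this identity, with 2J_x = Jp + Jm and 2iJ_y = Jp - Jm. -/
lemma cas_R (v : E) : S.cas (S.R v) = S.R (S.cas v) := by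
  have key : ∀ w, (4 : ℂ) • S.cas w = (S.Jp (S.Jp w + S.Jm w) + S.Jm (S.Jp w + S.Jm w))
      - (S.Jp (S.Jp w - S.Jm w) - S.Jm (S.Jp w - S.Jm w)) + (4 : ℂ) • S.Jz (S.Jz w) := by
    intro w
    simp only [cas_apply, map_add, map_sub, S.Jp_Jm]
    module
  have hx : S.R (S.Jp (S.Jp v + S.Jm v) + S.Jm (S.Jp v + S.Jm v)) =
      -(S.Jp (S.Jp (S.R v) - S.Jm (S.R v)) - S.Jm (S.Jp (S.R v) - S.Jm (S.R v))) := by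
    rw [S.R_Jx, S.R_Jx, map_smul, map_smul, ← smul_sub, smul_smul, neg_mul_neg, Complex.I_mul_I,
      neg_one_smul]
  have hy : S.R (S.Jp (S.Jp v - S.Jm v) - S.Jm (S.Jp v - S.Jm v)) =
      -(4 : ℂ) • S.Jz (S.Jz (S.R v)) := by
    rw [S.R_Jy, S.R_Jy, map_smul, smul_smul]
    congr 1
    linear_combination 4 * Complex.I_mul_I
  have hz : (4 : ℂ) • S.R (S.Jz (S.Jz v)) = S.Jp (S.Jp (S.R v) + S.Jm (S.R v))
      + S.Jm (S.Jp (S.R v) + S.Jm (S.R v)) := by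
    rw [show (4 : ℂ) = 2 * 2 by norm_num, mul_smul, S.R_Jz, ← S.R_Jz v, map_smul, map_smul,
      smul_add]
  have h4 : (4 : ℂ) • S.cas (S.R v) = (4 : ℂ) • S.R (S.cas v) := by
    rw [← map_smul S.R, key, key v, map_add S.R, map_sub S.R, hx, hy, map_smul S.R, hz]
    module
  exact smul_right_injective E (by norm_num : (4 : ℂ) ≠ 0) h4

lemma cas_R_symm (v : E) : S.cas (S.R.symm v) = S.R.symm (S.cas v) := by
  rw [← S.R.symm_apply_apply (S.cas (S.R.symm v)), ← cas_R, S.R.apply_symm_apply]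

lemma cas_projX (v : E) : S.cas (S.projX v) = S.projX (S.cas v) := by
  rw [projX_apply, projX_apply, cas_R, ← Q_cas, cas_R_symm]

lemma cas_projY (v : E) : S.cas (S.projY v) = S.projY (S.cas v) := by
  rw [projY_apply, projY_apply, cas_R_symm, ← Q_cas, cas_R]

lemma inner_projX (u v : E) : ⟪S.projX u, v⟫_ℂ = ⟪u, S.projX v⟫_ℂ := by
  rw [projX_apply, projX_apply, ← S.R.inner_map_map u, S.R.inner_map_eq_flip, inner_Q,
    ← S.R.inner_map_map, S.R.apply_symm_apply, S.R.inner_map_map]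

lemma inner_projY (u v : E) : ⟪S.projY u, v⟫_ℂ = ⟪u, S.projY v⟫_ℂ := by
  rw [projY_apply, projY_apply, S.R.symm.inner_map_eq_flip, inner_Q, S.R.symm_symm,
    ← S.R.symm.inner_map_map, S.R.symm_apply_apply]

lemma projX_projX (v : E) : S.projX (S.projX v) = S.projX v := S.projX_eq_self (S.Jx_projX v)

lemma projY_projY (v : E) : S.projY (S.projY v) = S.projY v := S.projY_eq_self (S.Jy_projY v)

/-- Twice the expectation of the Casimir operator is a sum of squared norms. -/
lemma J_eq_zero_of_cas {v : E} (h : S.cas v = 0) : S.Jp v = 0 ∧ S.Jm v = 0 ∧ S.Jz v = 0 := by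
  have h1 : ⟪v, (2 : ℂ) • S.cas v⟫_ℂ =
      ⟪S.Jp v, S.Jp v⟫_ℂ + ⟪S.Jm v, S.Jm v⟫_ℂ + 2 * ⟪S.Jz v, S.Jz v⟫_ℂ := by
    rw [S.inner_Jp, inner_Jm, S.inner_Jz, ← inner_smul_right, ← inner_add_right,
      ← inner_add_right, cas_apply, S.Jp_Jm]
    congr 1; module
  rw [h, smul_zero, inner_zero_right, inner_self_eq_norm_sq_to_K, inner_self_eq_norm_sq_to_K,
    inner_self_eq_norm_sq_to_K] at h1
  have h2 : (0 : ℝ) = ‖S.Jp v‖ ^ 2 + ‖S.Jm v‖ ^ 2 + 2 * ‖S.Jz v‖ ^ 2 := by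
    apply Complex.ofReal_injective
    push_cast
    exact h1
  have a1 := sq_nonneg ‖S.Jp v‖
  have a2 := sq_nonneg ‖S.Jm v‖
  have a3 := sq_nonneg ‖S.Jz v‖
  refine ⟨?_, ?_, ?_⟩ <;> rw [← norm_eq_zero, ← sq_eq_zero_iff] <;> linarith

/-- The average of the projections for the three axes. -/
def avg : E →L[ℂ] E := (3⁻¹ : ℂ) • (S.projX + S.projY + S.Q 0)

lemma avg_apply (v : E) : S.avg v = (3⁻¹ : ℂ) • (S.projX v + S.projY v + S.Q 0 v) := rfl

lemma inner_avg (u v : E) : ⟪S.avg u, v⟫_ℂ = ⟪u, S.avg v⟫_ℂ := by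
  simp only [avg_apply, inner_smul_left, inner_smul_right, inner_add_left, inner_add_right,
    inner_projX, inner_projY, inner_Q, map_inv₀, map_ofNat]

variable [FiniteDimensional ℂ E]

/-- The projection onto the invariant vectors. -/
def invProj : E →L[ℂ] E := (LinearMap.ker (S.cas : E →ₗ[ℂ] E)).starProjection

/-- The deviation of `S.avg` from the projection onto the invariant vectors. -/
def dev : E →L[ℂ] E := S.avg - S.invProj

lemma eq_invProj {v w : E} (hw : S.cas w = 0) (h : ∀ u, S.cas u = 0 → ⟪v - w, u⟫_ℂ = 0) :
    S.invProj v = w :=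
  (LinearMap.ker (S.cas : E →ₗ[ℂ] E)).eq_starProjection_of_mem_of_inner_eq_zero hw h

lemma cas_invProj (v : E) : S.cas (S.invProj v) = 0 :=
  (LinearMap.ker (S.cas : E →ₗ[ℂ] E)).starProjection_apply_mem v

lemma invProj_cas (v : E) : S.invProj (S.cas v) = 0 :=
  S.eq_invProj (map_zero _) fun u hu => by
    rw [sub_zero, inner_cas, hu, inner_zero_right]

lemma dev_apply (v : E) : S.dev v = S.avg v - S.invProj v := rfl

lemma dev_isSymmetric : (S.dev : E →ₗ[ℂ] E).IsSymmetric := by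
  intro u v
  change ⟪S.avg u - S.invProj u, v⟫_ℂ = ⟪u, S.avg v - S.invProj v⟫_ℂ
  rw [inner_sub_left, inner_sub_right, inner_avg]
  congr 1
  exact Submodule.inner_starProjection_left_eq_right _ u v

lemma dev_of_cas_zero {v : E} (h : S.cas v = 0) : S.dev v = 0 := by
  obtain ⟨hp, hm, hz⟩ := S.J_eq_zero_of_cas h
  rw [dev_apply, avg_apply, S.projX_eq_self (by simp [hp, hm]),
    S.projY_eq_self (by simp [hp, hm]), S.Q_zero_eq_self_iff.2 hz, S.eq_invProj h (by simp)]
  module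

lemma dev_of_cas {c : ℝ} (hc : c ≠ 0) {v : E} (h : S.cas v = (c : ℂ) • v) :
    S.dev v = S.avg v := by
  have h1 := S.invProj_cas v
  rw [h, map_smul, smul_eq_zero] at h1
  rw [dev_apply, h1.resolve_left (by exact_mod_cast hc), sub_zero]

lemma cas_dev (v : E) : S.cas (S.dev v) = S.dev (S.cas v) := by
  rw [dev_apply, dev_apply, map_sub, cas_invProj, invProj_cas, sub_zero, sub_zero, avg_apply,
    avg_apply, map_smul, map_add, map_add, cas_projX, cas_projY, Q_cas]

/-- The Casimir operator commutes with `S.dev`, so it preserves an eigenspace on which the norm is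
attained; being symmetric, it has a real eigenvalue there. -/
lemma exists_joint_eigenvector (hE : S.dev ≠ 0) :
    ∃ (k : ℂ) (c : ℝ) (u : E), ‖k‖ = ‖S.dev‖ ∧ u ≠ 0 ∧ S.dev u = k • u ∧
      S.cas u = (c : ℂ) • u := by
  have : Nontrivial E := by
    by_contra h
    rw [not_nontrivial_iff_subsingleton] at h
    exact hE (ContinuousLinearMap.ext fun v => Subsingleton.elim _ _)
  obtain ⟨k, hk, hk'⟩ := exists_hasEigenvalue_norm_eq S.dev_isSymmetric
  set V := Module.End.eigenspace (S.dev : E →ₗ[ℂ] E) k with hV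
  have hmem : ∀ v, v ∈ V ↔ S.dev v = k • v := fun v => Module.End.mem_eigenspace_iff
  have hinv : ∀ v ∈ V, (S.cas : E →ₗ[ℂ] E) v ∈ V := by
    intro v hv
    rw [hmem] at hv ⊢
    change S.dev (S.cas v) = k • S.cas v
    rw [← cas_dev, hv, map_smul]
  have : Nontrivial V := by
    obtain ⟨v, hv⟩ := hk.exists_hasEigenvector
    exact ⟨⟨v, hv.1⟩, 0, fun h => hv.2 (congrArg Subtype.val h)⟩
  obtain ⟨c, hc⟩ := Module.End.exists_eigenvalue ((S.cas : E →ₗ[ℂ] E).restrict hinv)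
  obtain ⟨u, hu⟩ := hc.exists_hasEigenvector
  have hu1 : S.cas u = c • (u : E) := congrArg Subtype.val hu.apply_eq_smul
  have hu0 : (u : E) ≠ 0 := fun h => hu.2 (Subtype.ext h)
  have hcr : (c.re : ℂ) = c := by
    rw [← Complex.conj_eq_iff_re]
    have h1 := S.inner_cas u u
    rw [hu1, inner_smul_left, inner_smul_right] at h1
    exact mul_right_cancel₀ (inner_self_ne_zero.2 hu0) h1
  exact ⟨k, c.re, u, hk', hu0, (hmem _).1 u.2, by rw [hcr, hu1]⟩

/-- An upper bound of the norm, in terms of triples of vectors fixed by the three axes. -/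
lemma norm_dev_le {L : ℝ} (hL : 0 ≤ L)
    (h : ∀ (c : ℝ) (x y z : E), c ≠ 0 → S.cas x = (c : ℂ) • x → S.cas y = (c : ℂ) • y →
      S.cas z = (c : ℂ) • z → S.Jp x + S.Jm x = 0 → S.Jp y - S.Jm y = 0 → S.Jz z = 0 →
      ‖x + y + z‖ ^ 2 ≤ L * (‖x‖ ^ 2 + ‖y‖ ^ 2 + ‖z‖ ^ 2)) :
    3 * ‖S.dev‖ ≤ L := by
  by_cases h0 : S.dev = 0
  · simpa [h0] using hL
  obtain ⟨k, c, u, hk, hu, hdu, hcu⟩ := S.exists_joint_eigenvector h0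
  rw [← hk]
  rcases eq_or_ne c 0 with rfl | hc
  · rw [Complex.ofReal_zero, zero_smul] at hcu
    rw [S.dev_of_cas_zero hcu, eq_comm, smul_eq_zero] at hdu
    simpa [hdu.resolve_right hu] using hL
  rw [S.dev_of_cas hc hcu] at hdu
  have hsum : S.projX u + S.projY u + S.Q 0 u = (3 * k) • u := by
    rw [mul_smul, ← hdu, avg_apply]; module
  have hq := h c (S.projX u) (S.projY u) (S.Q 0 u) hc (by rw [cas_projX, hcu, map_smul])
    (by rw [cas_projY, hcu, map_smul]) (by rw [← Q_cas, hcu, map_smul]) (S.Jx_projX u)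
    (S.Jy_projY u) (S.Jz_Q_zero u)
  -- Pairing the sum 3k u with u gives the sum of the squared norms of the three projections.
  have hn : ((‖S.projX u‖ ^ 2 + ‖S.projY u‖ ^ 2 + ‖S.Q 0 u‖ ^ 2 : ℝ) : ℂ) =
      3 * k * (‖u‖ ^ 2 : ℝ) := by
    have e1 : ⟪S.projX u, S.projX u⟫_ℂ = ⟪u, S.projX u⟫_ℂ := by rw [inner_projX, projX_projX]
    have e2 : ⟪S.projY u, S.projY u⟫_ℂ = ⟪u, S.projY u⟫_ℂ := by rw [inner_projY, projY_projY]
    have e3 : ⟪S.Q 0 u, S.Q 0 u⟫_ℂ = ⟪u, S.Q 0 u⟫_ℂ := by rw [inner_Q, Q_Q_self]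
    have e : ⟪S.projX u, S.projX u⟫_ℂ + ⟪S.projY u, S.projY u⟫_ℂ + ⟪S.Q 0 u, S.Q 0 u⟫_ℂ =
        3 * k * ⟪u, u⟫_ℂ := by
      rw [e1, e2, e3, ← inner_add_right, ← inner_add_right, hsum, inner_smul_right]
    simp only [inner_self_eq_norm_sq_to_K] at e
    exact_mod_cast e
  have hn' : ‖S.projX u‖ ^ 2 + ‖S.projY u‖ ^ 2 + ‖S.Q 0 u‖ ^ 2 = 3 * ‖k‖ * ‖u‖ ^ 2 := by
    have := congrArg norm hn
    rwa [Complex.norm_real, norm_mul, norm_mul, Complex.norm_real, Real.norm_of_nonneg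
      (by positivity), Real.norm_of_nonneg (by positivity), Complex.norm_ofNat] at this
  rw [hn', hsum, norm_smul, norm_mul, Complex.norm_ofNat] at hq
  have hu' : 0 < ‖u‖ ^ 2 := by positivity
  by_contra hlt
  push Not at hlt
  -- The inequality is 9‖k‖²‖u‖² ≤ 3L‖k‖‖u‖².
  nlinarith [mul_pos hu' (sub_pos.2 hlt), mul_pos (mul_pos hu' (sub_pos.2 hlt)) (hL.trans_lt hlt)]

/-- A lower bound of the norm, in terms of triples of vectors fixed by the three axes. -/
lemma le_norm_dev {c L : ℝ} (hc : c ≠ 0) {x y z : E} (hx : S.cas x = (c : ℂ) • x)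
    (hy : S.cas y = (c : ℂ) • y) (hz : S.cas z = (c : ℂ) • z) (hxx : S.Jp x + S.Jm x = 0)
    (hyy : S.Jp y - S.Jm y = 0) (hzz : S.Jz z = 0) (h0 : 0 < ‖x‖ ^ 2 + ‖y‖ ^ 2 + ‖z‖ ^ 2)
    (h : L * (‖x‖ ^ 2 + ‖y‖ ^ 2 + ‖z‖ ^ 2) ≤ ‖x + y + z‖ ^ 2) :
    L ≤ 3 * ‖S.dev‖ := by
  set u := x + y + z with hu
  set a := S.projX u
  set b := S.projY u
  set d := S.Q 0 u
  have hcu : S.cas u = (c : ℂ) • u := by simp only [hu, map_add, hx, hy, hz, smul_add]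
  have hd := S.dev_of_cas hc hcu
  have e1 : ⟪a, a⟫_ℂ = ⟪u, a⟫_ℂ := by rw [inner_projX, projX_projX]
  have e2 : ⟪b, b⟫_ℂ = ⟪u, b⟫_ℂ := by rw [inner_projY, projY_projY]
  have e3 : ⟪d, d⟫_ℂ = ⟪u, d⟫_ℂ := by rw [inner_Q, Q_Q_self]
  have hs : a + b + d = (3 : ℂ) • S.avg u := by rw [avg_apply]; module
  have hN : ‖a‖ ^ 2 + ‖b‖ ^ 2 + ‖d‖ ^ 2 ≤ 3 * ‖S.dev‖ * ‖u‖ ^ 2 := by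
    have e : ((‖a‖ ^ 2 + ‖b‖ ^ 2 + ‖d‖ ^ 2 : ℝ) : ℂ) = ⟪u, (3 : ℂ) • S.dev u⟫_ℂ := by
      rw [hd, ← hs, inner_add_right, inner_add_right, ← e1, ← e2, ← e3]
      simp only [inner_self_eq_norm_sq_to_K]
      push_cast; rfl
    have e' := congrArg norm e
    rw [Complex.norm_real, Real.norm_of_nonneg (by positivity)] at e'
    rw [e']
    refine (norm_inner_le_norm _ _).trans ?_
    rw [norm_smul, Complex.norm_ofNat]
    nlinarith [S.dev.le_opNorm u, norm_nonneg u]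
  -- Each of x, y, z is fixed by its projection, which is moved onto u. Cauchy–Schwarz together with
  -- `hN` then gives ‖u‖⁴ ≤ s · 3‖dev‖ ‖u‖².
  have hU : ‖u‖ ^ 2 ≤ ‖x‖ * ‖a‖ + ‖y‖ * ‖b‖ + ‖z‖ * ‖d‖ := by
    have e : ((‖u‖ ^ 2 : ℝ) : ℂ) = ⟪x, a⟫_ℂ + ⟪y, b⟫_ℂ + ⟪z, d⟫_ℂ := by
      rw [← inner_projX, ← inner_projY, ← inner_Q, S.projX_eq_self hxx, S.projY_eq_self hyy,
        S.Q_zero_eq_self_iff.2 hzz, ← inner_add_left, ← inner_add_left, ← hu,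
        inner_self_eq_norm_sq_to_K]
      push_cast; rfl
    have e' := congrArg norm e
    rw [Complex.norm_real, Real.norm_of_nonneg (by positivity)] at e'
    rw [e']
    refine (norm_add₃_le).trans ?_
    gcongr <;> exact norm_inner_le_norm _ _
  set s := ‖x‖ ^ 2 + ‖y‖ ^ 2 + ‖z‖ ^ 2
  have hCS : (‖x‖ * ‖a‖ + ‖y‖ * ‖b‖ + ‖z‖ * ‖d‖) ^ 2 ≤
      s * (‖a‖ ^ 2 + ‖b‖ ^ 2 + ‖d‖ ^ 2) := by
    nlinarith [sq_nonneg (‖x‖ * ‖b‖ - ‖y‖ * ‖a‖), sq_nonneg (‖x‖ * ‖d‖ - ‖z‖ * ‖a‖),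
      sq_nonneg (‖y‖ * ‖d‖ - ‖z‖ * ‖b‖)]
  have hD := norm_nonneg S.dev
  rcases (sq_nonneg ‖u‖).eq_or_lt with hu0 | hu0
  · rw [← hu0] at h
    by_contra hlt
    push Not at hlt
    nlinarith
  have h1 : ‖u‖ ^ 2 * ‖u‖ ^ 2 ≤ s * (3 * ‖S.dev‖ * ‖u‖ ^ 2) :=
    calc ‖u‖ ^ 2 * ‖u‖ ^ 2 = (‖u‖ ^ 2) ^ 2 := by ring
      _ ≤ (‖x‖ * ‖a‖ + ‖y‖ * ‖b‖ + ‖z‖ * ‖d‖) ^ 2 := by gcongr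
      _ ≤ s * (‖a‖ ^ 2 + ‖b‖ ^ 2 + ‖d‖ ^ 2) := hCS
      _ ≤ _ := by gcongr
  have h2 : ‖u‖ ^ 2 ≤ s * (3 * ‖S.dev‖) := by
    refine le_of_mul_le_mul_right (h1.trans_eq ?_) hu0
    ring
  have h3 : L * s ≤ 3 * ‖S.dev‖ * s := by linarith
  exact le_of_mul_le_mul_right h3 h0

end SpinRep

/-! ### Upper and lower bounds for each Casimir eigenvalue. -/

namespace SpinRep

variable {E : Type*} [NormedAddCommGroup E] [InnerProductSpace ℂ E] {t : ℕ} (S : SpinRep E t)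

lemma norm_inner_le_norm_Q_zero (x : E) {z : E} (hz : S.Jz z = 0) :
    ‖⟪x, z⟫_ℂ‖ ≤ ‖S.Q 0 x‖ * ‖z‖ := by
  rw [← S.Q_zero_eq_self_iff.2 hz, ← inner_Q, S.Q_zero_eq_self_iff.2 hz]
  exact norm_inner_le_norm _ _

/-- The bound `r` controls the inner product of vectors fixed by the first and third axes; the
cyclic rotation brings the other two pairs to this one. Then |ab| + |bc| + |ca| ≤ a² + b² + c². -/
lemma norm_add_sq_le_of_norm_Q_zero_le {c r : ℝ} (hr : 0 ≤ r)
    (h : ∀ v, S.cas v = (c : ℂ) • v → S.Jp v + S.Jm v = 0 → ‖S.Q 0 v‖ ≤ r * ‖v‖) {x y z : E}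
    (hx : S.cas x = (c : ℂ) • x) (hy : S.cas y = (c : ℂ) • y)
    (hz : S.cas z = (c : ℂ) • z) (hxx : S.Jp x + S.Jm x = 0)
    (hyy : S.Jp y - S.Jm y = 0) (hzz : S.Jz z = 0) :
    ‖x + y + z‖ ^ 2 ≤ (1 + 2 * r) * (‖x‖ ^ 2 + ‖y‖ ^ 2 + ‖z‖ ^ 2) := by
  have key : ∀ u v, S.cas u = (c : ℂ) • u → S.Jp u + S.Jm u = 0 → S.Jz v = 0 →
      ‖⟪u, v⟫_ℂ‖ ≤ r * (‖u‖ * ‖v‖) := by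
    intro u v hu huu hv
    rw [← mul_assoc]
    exact (S.norm_inner_le_norm_Q_zero u hv).trans (by gcongr; exact h u hu huu)
  have hR : ∀ v, S.cas v = (c : ℂ) • v → S.cas (S.R v) = (c : ℂ) • S.R v := by
    intro v hv
    rw [cas_R, hv, map_smul]
  have h1 : ‖⟪x, z⟫_ℂ‖ ≤ r * (‖x‖ * ‖z‖) := key x z hx hxx hzz
  have h2 : ‖⟪z, y⟫_ℂ‖ ≤ r * (‖z‖ * ‖y‖) := by
    have := key (S.R z) (S.R y) (hR z hz) (S.R_of_Jz hzz) (S.R_of_Jy hyy)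
    rwa [S.R.inner_map_map, S.R.norm_map, S.R.norm_map] at this
  have h3 : ‖⟪y, x⟫_ℂ‖ ≤ r * (‖y‖ * ‖x‖) := by
    have := key (S.R (S.R y)) (S.R (S.R x)) (hR _ (hR y hy)) (S.R_of_Jz (S.R_of_Jy hyy))
      (S.R_of_Jy (S.R_of_Jx hxx))
    rwa [S.R.inner_map_map, S.R.inner_map_map, S.R.norm_map, S.R.norm_map, S.R.norm_map,
      S.R.norm_map] at this
  have e : ‖x + y + z‖ ^ 2 = ‖x‖ ^ 2 + ‖y‖ ^ 2 + ‖z‖ ^ 2 +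
      2 * (RCLike.re ⟪x, z⟫_ℂ + RCLike.re ⟪z, y⟫_ℂ + RCLike.re ⟪y, x⟫_ℂ) := by
    rw [norm_add_sq (𝕜 := ℂ), norm_add_sq (𝕜 := ℂ), inner_add_left, map_add, inner_re_symm y x,
      inner_re_symm z y]
    ring
  have g1 := (RCLike.re_le_norm _).trans h1
  have g2 := (RCLike.re_le_norm _).trans h2
  have g3 := (RCLike.re_le_norm _).trans h3
  rw [e]
  have f : ‖x‖ * ‖z‖ + ‖z‖ * ‖y‖ + ‖y‖ * ‖x‖ ≤ ‖x‖ ^ 2 + ‖y‖ ^ 2 + ‖z‖ ^ 2 := by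
    nlinarith [sq_nonneg (‖x‖ - ‖y‖), sq_nonneg (‖x‖ - ‖z‖), sq_nonneg (‖y‖ - ‖z‖)]
  have f' := mul_le_mul_of_nonneg_left f hr
  linarith

lemma eq_smul_of_Jx {v : E} (h : S.Jp v + S.Jm v = 0) : S.Jp v = (-1 : ℂ) • S.Jm v := by
  rw [neg_one_smul]; exact eq_neg_of_add_eq_zero_left h

lemma eq_smul_of_Jy {v : E} (h : S.Jp v - S.Jm v = 0) : S.Jp v = (1 : ℂ) • S.Jm v := by
  rw [one_smul]; exact sub_eq_zero.1 h

/-- No zero-weight component survives, so the three fixed spaces are pairwise orthogonal. -/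
lemma norm_add_sq_le_of_lt_four {c : ℝ} (ht : t < 4) (hc : c ≠ 0) (hc' : c ≠ 6 ∨ t < 2) {x y z : E}
    (hx : S.cas x = (c : ℂ) • x) (hy : S.cas y = (c : ℂ) • y)
    (hz : S.cas z = (c : ℂ) • z) (hxx : S.Jp x + S.Jm x = 0)
    (hyy : S.Jp y - S.Jm y = 0) (hzz : S.Jz z = 0) :
    ‖x + y + z‖ ^ 2 ≤ 1 * (‖x‖ ^ 2 + ‖y‖ ^ 2 + ‖z‖ ^ 2) := by
  have := S.norm_add_sq_le_of_norm_Q_zero_le (r := 0) le_rfl (fun v hv hvv => ?_) hx hy hz hxx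
    hyy hzz
  · simpa using this
  rcases S.zero_weight_cases (by simp) hv (S.eq_smul_of_Jx hvv) hc with h | h | h
  · simp [h]
  · rcases hc' with h' | h'
    · exact absurd h.1 h'
    · omega
  · omega

lemma norm_add_sq_le_of_ne_six {c : ℝ} (hc : c ≠ 0) (hc' : c ≠ 6) {x y z : E}
    (hx : S.cas x = (c : ℂ) • x) (hy : S.cas y = (c : ℂ) • y)
    (hz : S.cas z = (c : ℂ) • z) (hxx : S.Jp x + S.Jm x = 0)
    (hyy : S.Jp y - S.Jm y = 0) (hzz : S.Jz z = 0) :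
    ‖x + y + z‖ ^ 2 ≤ 7 / 4 * (‖x‖ ^ 2 + ‖y‖ ^ 2 + ‖z‖ ^ 2) := by
  have := S.norm_add_sq_le_of_norm_Q_zero_le (r := 3 / 8) (by norm_num) (fun v hv hvv => ?_) hx hy
    hz hxx hyy hzz
  · norm_num at this; exact this
  rcases S.zero_weight_cases (by simp) hv (S.eq_smul_of_Jx hvv) hc with h | h | h
  · rw [h, norm_zero]; positivity
  · exact absurd h.1 hc'
  · refine abs_le_of_sq_le_sq' ?_ (by positivity) |>.2
    linarith [h.2.2]

lemma norm_add_sq_le_of_eq_six {x y z : E} (hx : S.cas x = ((6 : ℝ) : ℂ) • x)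
    (hy : S.cas y = ((6 : ℝ) : ℂ) • y) (hxx : S.Jp x + S.Jm x = 0) (hyy : S.Jp y - S.Jm y = 0)
    (hz : S.Jz z = 0) : ‖x + y + z‖ ^ 2 ≤ 3 / 2 * (‖x‖ ^ 2 + ‖y‖ ^ 2 + ‖z‖ ^ 2) := by
  have h4 : ∀ {e : ℂ}, ‖e‖ = 1 → ∀ v, S.cas v = ((6 : ℝ) : ℂ) • v → S.Jp v = e • S.Jm v →
      4 * ‖S.Q 0 v‖ ^ 2 ≤ ‖v‖ ^ 2 := by
    intro e he v hv hvv
    rcases S.zero_weight_cases he hv hvv (by norm_num) with h | h | h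
    · rw [h, norm_zero]; nlinarith [sq_nonneg ‖v‖]
    · exact h.2.2
    · norm_num at h
  exact S.norm_add_sq_le_of_cas_six hx hy hxx hyy hz (h4 (by simp) x hx (S.eq_smul_of_Jx hxx))
    (h4 (by simp) y hy (S.eq_smul_of_Jy hyy))

lemma norm_sq_add_of_weights {a b b' d d' : E} (ha : S.Jz a = ((0 : ℤ) : ℂ) • a)
    (hb : S.Jz b = ((2 : ℤ) : ℂ) • b) (hb' : S.Jz b' = ((-2 : ℤ) : ℂ) • b')
    (hd : S.Jz d = ((4 : ℤ) : ℂ) • d) (hd' : S.Jz d' = ((-4 : ℤ) : ℂ) • d') :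
    ‖a + b + b' + d + d'‖ ^ 2 = ‖a‖ ^ 2 + ‖b‖ ^ 2 + ‖b'‖ ^ 2 + ‖d‖ ^ 2 + ‖d'‖ ^ 2 := by
  have h := fun {m n : ℤ} {u v : E} => S.inner_eq_zero_of_ne (m := m) (n := n) (u := u) (v := v)
  rw [norm_add_sq (𝕜 := ℂ), norm_add_sq (𝕜 := ℂ), norm_add_sq (𝕜 := ℂ), norm_add_sq (𝕜 := ℂ)]
  simp only [inner_add_left, h ha hb (by decide), h ha hb' (by decide), h ha hd (by decide),
    h ha hd' (by decide), h hb hb' (by decide), h hb hd (by decide), h hb hd' (by decide),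
    h hb' hd (by decide), h hb' hd' (by decide), h hd hd' (by decide), add_zero, map_zero, mul_zero]

variable [FiniteDimensional ℂ E]

lemma le_norm_dev_of_ne_zero {c : ℝ} (hc : c ≠ 0) {z : E} (hz : S.IsWeight c 0 z) (h0 : z ≠ 0) :
    1 ≤ 3 * ‖S.dev‖ := by
  have hz0 : S.Jz z = 0 := by rw [hz.1, Int.cast_zero, zero_smul]
  have hzp : 0 < ‖z‖ ^ 2 := by positivity
  exact S.le_norm_dev hc (x := 0) (y := 0) (z := z) (by simp) (by simp) hz.2 (by simp) (by simp)
    hz0 (by simpa using hzp) (by simp)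

lemma le_norm_dev_of_six {z : E} (hz : S.IsWeight 6 0 z) (h0 : z ≠ 0) :
    3 / 2 ≤ 3 * ‖S.dev‖ := by
  have hp1 := hz.Jp
  have hp2 := hp1.Jp
  have hm1 := hz.Jm
  have hm2 := hm1.Jm
  have n1 := hz.norm_Jp
  have n2 := hp1.norm_Jp
  have n3 := hp2.norm_Jp
  have k1 := hz.norm_Jm
  have k2 := hm1.norm_Jm
  have k3 := hm2.norm_Jm
  have r2 := hp1.Jm_Jp
  have s2 := hm1.Jp_Jm
  norm_num at hp1 hp2 hm1 hm2 n1 n2 n3 k1 k2 k3 r2 s2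
  set z1 := S.Jp z
  set z2 := S.Jp z1
  set w1 := S.Jm z
  set w2 := S.Jm w1
  have hzp : 0 < ‖z‖ ^ 2 := by positivity
  have nx : ∀ a b : ℂ, ‖a • z + b • z2 + b • w2‖ ^ 2 = (‖a‖ ^ 2 + 48 * ‖b‖ ^ 2) * ‖z‖ ^ 2 := by
    intro a b
    have := S.norm_sq_add_of_weights (hz.smul a).1 (hp2.smul b).1 (hm2.smul b).1
      (d := 0) (d' := 0) (by simp) (by simp)
    rw [add_zero, add_zero] at this
    rw [this, norm_smul, norm_smul, norm_smul, mul_pow, mul_pow, mul_pow, n2, k2, n1, k1, norm_zero]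
    ring
  have cx : ∀ a b : ℂ, S.cas (a • z + b • z2 + b • w2) =
      ((6 : ℝ) : ℂ) • (a • z + b • z2 + b • w2) := by
    intro a b
    rw [map_add, map_add, (hz.smul a).2, (hp2.smul b).2, (hm2.smul b).2, smul_add, smul_add]
  -- In weights ±1, being fixed by the first axis means a + 4b = 0, by the second a - 4b = 0. The
  -- signs make the weight-0 parts cancel: this is the Gram eigenvector (1, -1, 0) for 3/2, with
  -- norms 12 and 4 + 4 in units of ‖z‖².
  refine S.le_norm_dev (c := 6) (by norm_num) (x := (1 : ℂ) • z + (-1 / 4 : ℂ) • z2 + (-1 / 4 : ℂ) • w2)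
    (y := (-1 : ℂ) • z + (-1 / 4 : ℂ) • z2 + (-1 / 4 : ℂ) • w2) (z := 0) (cx _ _) (cx _ _) (by simp)
    ?_ ?_ (by simp) ?_ ?_
  · simp only [map_add, map_smul, n3, k3, r2, s2]
    module
  · simp only [map_add, map_smul, n3, k3, r2, s2]
    module
  · rw [nx, nx]; norm_num; linarith
  · rw [show (1 : ℂ) • z + (-1 / 4 : ℂ) • z2 + (-1 / 4 : ℂ) • w2 + ((-1 : ℂ) • z
      + (-1 / 4 : ℂ) • z2 + (-1 / 4 : ℂ) • w2) + 0 =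
      (0 : ℂ) • z + (-1 / 2 : ℂ) • z2 + (-1 / 2 : ℂ) • w2 by module, nx, nx, nx]
    norm_num
    linarith

lemma le_norm_dev_of_twenty {z : E} (hz : S.IsWeight 20 0 z) (h0 : z ≠ 0) :
    7 / 4 ≤ 3 * ‖S.dev‖ := by
  have hp1 := hz.Jp
  have hp2 := hp1.Jp
  have hp3 := hp2.Jp
  have hp4 := hp3.Jp
  have hm1 := hz.Jm
  have hm2 := hm1.Jm
  have hm3 := hm2.Jm
  have hm4 := hm3.Jm
  have n1 := hz.norm_Jp
  have n2 := hp1.norm_Jp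
  have n3 := hp2.norm_Jp
  have n4 := hp3.norm_Jp
  have n5 := hp4.norm_Jp
  have k1 := hz.norm_Jm
  have k2 := hm1.norm_Jm
  have k3 := hm2.norm_Jm
  have k4 := hm3.norm_Jm
  have k5 := hm4.norm_Jm
  have r2 := hp1.Jm_Jp
  have r4 := hp3.Jm_Jp
  have s2 := hm1.Jp_Jm
  have s4 := hm3.Jp_Jm
  norm_num at hp1 hp2 hp3 hp4 hm1 hm2 hm3 hm4 n1 n2 n3 n4 n5 k1 k2 k3 k4 k5 r2 r4 s2 s4
  set z1 := S.Jp z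
  set z2 := S.Jp z1
  set z3 := S.Jp z2
  set z4 := S.Jp z3
  set w1 := S.Jm z
  set w2 := S.Jm w1
  set w3 := S.Jm w2
  set w4 := S.Jm w3
  have hzp : 0 < ‖z‖ ^ 2 := by positivity
  set f : ℂ → ℂ → ℂ → E := fun a b d => a • z + b • z2 + b • w2 + d • z4 + d • w4 with hf
  have nx : ∀ a b d : ℂ, ‖f a b d‖ ^ 2 =
      (‖a‖ ^ 2 + 720 * ‖b‖ ^ 2 + 80640 * ‖d‖ ^ 2) * ‖z‖ ^ 2 := by
    intro a b d
    rw [hf, S.norm_sq_add_of_weights (hz.smul a).1 (hp2.smul b).1 (hm2.smul b).1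
      (hp4.smul d).1 (hm4.smul d).1, norm_smul, norm_smul, norm_smul, norm_smul, norm_smul,
      mul_pow, mul_pow, mul_pow, mul_pow, mul_pow, n4, k4, n3, k3, n2, k2, n1, k1]
    ring
  have cx : ∀ a b d : ℂ, S.cas (f a b d) = ((20 : ℝ) : ℂ) • f a b d := by
    intro a b d
    rw [hf, map_add, map_add, map_add, map_add, (hz.smul a).2, (hp2.smul b).2, (hm2.smul b).2,
      (hp4.smul d).2, (hm4.smul d).2]
    module
  have hz8 : S.IsWeight 20 0 (f (8 / 3) 0 0) := by
    rw [hf]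
    simpa using hz.smul (8 / 3)
  -- The coefficients solve a ± 18b = 0 and b ± 8d = 0, plus sign for the first axis. All three
  -- vectors have norm 8/3 in units of ‖z‖, so this is the Gram eigenvector (1, 1, 1) for 1 + 2 ·
  -- 3/8.
  refine S.le_norm_dev (c := 20) (by norm_num) (x := f 1 (-1 / 18) (1 / 144))
    (y := f 1 (1 / 18) (1 / 144)) (z := f (8 / 3) 0 0) (cx _ _ _) (cx _ _ _) (cx _ _ _)
    ?_ ?_ ?_ ?_ ?_
  · simp only [hf, map_add, map_smul, n5, k5, r2, s2, r4, s4]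
    module
  · simp only [hf, map_add, map_smul, n5, k5, r2, s2, r4, s4]
    module
  · rw [hz8.1, Int.cast_zero, zero_smul]
  · rw [nx, nx, nx]; norm_num; linarith
  · rw [show f 1 (-1 / 18) (1 / 144) + f 1 (1 / 18) (1 / 144) + f (8 / 3) 0 0 =
      f (14 / 3) 0 (1 / 72) by simp only [hf]; module, nx, nx, nx, nx]
    norm_num
    linarith

/-- The norm of the deviation, given vectors of highest weight one, two and four. -/
theorem norm_dev (ht : 1 ≤ t) (hw : ∀ k : ℕ, k ≤ t → ∃ v ≠ 0, S.Jz v = (k : ℂ) • v ∧ S.Jp v = 0) :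
    3 * ‖S.dev‖ = if t = 1 then 1 else if t = 2 ∨ t = 3 then 3 / 2 else 7 / 4 := by
  have hw' : ∀ k : ℕ, k ≤ t → ∃ v ≠ 0, S.IsWeight (k * (k + 1)) k v := by
    intro k hk
    obtain ⟨v, hv0, hv, hvp⟩ := hw k hk
    refine ⟨v, hv0, by simpa using hv, ?_⟩
    rw [cas_apply, hvp, hv, map_smul, hv, map_zero]
    push_cast; module
  -- Used to lower a highest weight vector down to weight 0 without reaching zero.
  have hstep : ∀ {c : ℝ} {m : ℤ} {v : E}, S.IsWeight c m v → v ≠ 0 → 0 < c - m * (m - 1) →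
      S.Jm v ≠ 0 := by
    intro c m v hv h0 hc h
    have := hv.norm_Jm
    rw [h, norm_zero] at this
    have : 0 < ‖v‖ ^ 2 := by positivity
    nlinarith
  have l1 : 1 ≤ 3 * ‖S.dev‖ := by
    obtain ⟨v, hv0, hv⟩ := hw' 1 ht
    norm_num at hv
    exact S.le_norm_dev_of_ne_zero two_ne_zero hv.Jm (hstep hv hv0 (by norm_num))
  apply le_antisymm
  · apply S.norm_dev_le (by split_ifs <;> norm_num)
    intro c x y z hc hx hy hz hxx hyy hzz
    split_ifs with h1 h2
    · exact S.norm_add_sq_le_of_lt_four (by omega) hc (Or.inr (by omega)) hx hy hz hxx hyy hzz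
    · rcases eq_or_ne c 6 with rfl | h6
      · exact S.norm_add_sq_le_of_eq_six hx hy hxx hyy hzz
      · refine (S.norm_add_sq_le_of_lt_four (by omega) hc (Or.inl h6) hx hy hz hxx hyy hzz).trans ?_
        gcongr; norm_num
    · rcases eq_or_ne c 6 with rfl | h6
      · refine (S.norm_add_sq_le_of_eq_six hx hy hxx hyy hzz).trans ?_
        exact mul_le_mul_of_nonneg_right (by norm_num) (by positivity)
      · exact S.norm_add_sq_le_of_ne_six hc h6 hx hy hz hxx hyy hzz
  · split_ifs with h1 h2
    · exact l1
    · obtain ⟨v, hv0, hv⟩ := hw' 2 (by omega)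
      norm_num at hv
      have a1 := hstep hv hv0 (by norm_num)
      have b1 := hv.Jm
      norm_num at b1
      have a2 := hstep b1 a1 (by norm_num)
      have b2 := b1.Jm
      norm_num at b2
      exact S.le_norm_dev_of_six b2 a2
    · obtain ⟨v, hv0, hv⟩ := hw' 4 (by omega)
      norm_num at hv
      have a1 := hstep hv hv0 (by norm_num)
      have b1 := hv.Jm
      norm_num at b1
      have a2 := hstep b1 a1 (by norm_num)
      have b2 := b1.Jm
      norm_num at b2
      have a3 := hstep b2 a2 (by norm_num)
      have b3 := b2.Jm
      norm_num at b3
      have a4 := hstep b3 a3 (by norm_num)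
      have b4 := b3.Jm
      norm_num at b4
      exact S.le_norm_dev_of_twenty b4 a4

end SpinRep

/-! ### Tensor powers of matrices and their derived action. -/

variable {N t : ℕ}

/-- The tensor product of a family of matrices. -/
def tens (f : Fin t → Matrix (Fin N) (Fin N) ℂ) : Matrix (Fin t → Fin N) (Fin t → Fin N) ℂ :=
  Matrix.of fun r s => ∏ j, f j (r j) (s j)

lemma tens_apply (f : Fin t → Matrix (Fin N) (Fin N) ℂ) (r s : Fin t → Fin N) :
    tens f r s = ∏ j, f j (r j) (s j) := rfl

lemma tensorPow_eq_tens (A : Matrix (Fin N) (Fin N) ℂ) : tensorPow t A = tens fun _ => A := rfl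

lemma tens_mul (f g : Fin t → Matrix (Fin N) (Fin N) ℂ) : tens f * tens g = tens (f * g) := by
  ext r s
  simp only [Matrix.mul_apply, tens_apply, Pi.mul_apply, Fintype.prod_sum, Finset.prod_mul_distrib]

lemma tens_one : tens (1 : Fin t → Matrix (Fin N) (Fin N) ℂ) = 1 := by
  ext r s
  simp only [tens_apply, Pi.one_apply, Matrix.one_apply, Finset.prod_ite_zero,
    Finset.prod_const_one, Finset.mem_univ, true_implies, funext_iff]

lemma tens_eq_zero {f : Fin t → Matrix (Fin N) (Fin N) ℂ} (j : Fin t) (h : f j = 0) :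
    tens f = 0 := by
  ext r s
  exact Finset.prod_eq_zero (Finset.mem_univ j) (by rw [h]; rfl)

lemma conjTranspose_tens (f : Fin t → Matrix (Fin N) (Fin N) ℂ) :
    (tens f)ᴴ = tens fun j => (f j)ᴴ := by
  ext r s
  simp [tens_apply, Matrix.conjTranspose_apply]

lemma transpose_tens (f : Fin t → Matrix (Fin N) (Fin N) ℂ) :
    (tens f)ᵀ = tens fun j => (f j)ᵀ := rfl

lemma tens_mulSingle_apply (j : Fin t) (A : Matrix (Fin N) (Fin N) ℂ) (r s : Fin t → Fin N) :
    tens (Pi.mulSingle j A) r s = (if ∀ i ≠ j, r i = s i then 1 else 0) * A (r j) (s j) := by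
  rw [tens_apply, ← Finset.prod_erase_mul _ _ (Finset.mem_univ j), Pi.mulSingle_eq_same]
  congr 1
  rw [Finset.prod_congr rfl (g := fun i => if r i = s i then (1 : ℂ) else 0), Finset.prod_ite_zero,
    Finset.prod_const_one]
  · simp
  · intro i hi
    rw [Pi.mulSingle_eq_of_ne (Finset.ne_of_mem_erase hi), Matrix.one_apply]

variable (N t) in
/-- The derivative at the identity of the tensor power. -/
def deriv : Matrix (Fin N) (Fin N) ℂ →ₗ[ℂ] Matrix (Fin t → Fin N) (Fin t → Fin N) ℂ where
  toFun A := ∑ j, tens (Pi.mulSingle j A)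
  map_add' A B := by
    rw [← Finset.sum_add_distrib]
    refine Finset.sum_congr rfl fun j _ => ?_
    ext r s
    simp only [Matrix.add_apply, tens_mulSingle_apply, mul_add]
  map_smul' c A := by
    rw [Finset.smul_sum]
    refine Finset.sum_congr rfl fun j _ => ?_
    ext r s
    simp only [Matrix.smul_apply, tens_mulSingle_apply, smul_eq_mul, RingHom.id_apply]
    ring

lemma deriv_apply (A : Matrix (Fin N) (Fin N) ℂ) :
    deriv N t A = ∑ j, tens (Pi.mulSingle j A) := rfl

lemma deriv_one : deriv N t 1 = (t : ℂ) • 1 := by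
  simp only [deriv_apply, Pi.mulSingle_one, tens_one, Finset.sum_const, Finset.card_univ,
    Fintype.card_fin]
  rw [Nat.cast_smul_eq_nsmul]

lemma conjTranspose_deriv (A : Matrix (Fin N) (Fin N) ℂ) : (deriv N t A)ᴴ = deriv N t Aᴴ := by
  simp only [deriv_apply, Matrix.conjTranspose_sum, conjTranspose_tens]
  refine Finset.sum_congr rfl fun j _ => congrArg tens (funext fun i => ?_)
  rcases eq_or_ne i j with rfl | h
  · simp
  · simp [Pi.mulSingle_eq_of_ne h]

lemma transpose_deriv (A : Matrix (Fin N) (Fin N) ℂ) : (deriv N t A)ᵀ = deriv N t Aᵀ := by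
  simp only [deriv_apply, Matrix.transpose_sum, transpose_tens]
  refine Finset.sum_congr rfl fun j _ => congrArg tens (funext fun i => ?_)
  rcases eq_or_ne i j with rfl | h
  · simp
  · simp [Pi.mulSingle_eq_of_ne h]

/-- Matrices acting in different tensor slots commute, so only the diagonal terms of the double sum
remain. -/
lemma deriv_mul_sub (A B : Matrix (Fin N) (Fin N) ℂ) :
    deriv N t A * deriv N t B - deriv N t B * deriv N t A = deriv N t (A * B - B * A) := by
  rw [map_sub]
  simp only [deriv_apply, Finset.sum_mul, Finset.mul_sum, tens_mul]
  rw [Finset.sum_comm, ← Finset.sum_sub_distrib, ← Finset.sum_sub_distrib]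
  refine Finset.sum_congr rfl fun j _ => ?_
  rw [← Finset.sum_sub_distrib, Finset.sum_eq_single_of_mem j (Finset.mem_univ j),
    ← Pi.mulSingle_mul, ← Pi.mulSingle_mul]
  intro i _ hij
  rw [(Pi.mulSingle_commute (f := fun _ => Matrix (Fin N) (Fin N) ℂ) (Ne.symm hij) A B).eq, sub_self]

lemma tensorPow_mul (A B : Matrix (Fin N) (Fin N) ℂ) :
    tensorPow t A * tensorPow t B = tensorPow t (A * B) := tens_mul _ _

lemma tensorPow_one : tensorPow t (1 : Matrix (Fin N) (Fin N) ℂ) = 1 := tens_one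

lemma tensorPow_mul_deriv {V W : Matrix (Fin N) (Fin N) ℂ} (h : W * V = 1)
    (A : Matrix (Fin N) (Fin N) ℂ) :
    tensorPow t V * deriv N t A = deriv N t (V * A * W) * tensorPow t V := by
  simp only [deriv_apply, tensorPow_eq_tens, Finset.sum_mul, Finset.mul_sum, tens_mul]
  refine Finset.sum_congr rfl fun j _ => congrArg tens (funext fun i => ?_)
  rcases eq_or_ne i j with rfl | hij
  · simp [mul_assoc, h]
  · simp [Pi.mulSingle_eq_of_ne hij]

lemma tensorOp_mul (A B A' B' : Matrix (Fin N) (Fin N) ℂ) :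
    tensorOp t A B * tensorOp t A' B' = tensorOp t (A * A') (B * B') := by
  rw [tensorOp, tensorOp, tensorOp, ← map_mul, ← Matrix.mul_kronecker_mul, tensorPow_mul,
    tensorPow_mul]

lemma tensorOp_one : tensorOp t (1 : Matrix (Fin N) (Fin N) ℂ) 1 = 1 := by
  rw [tensorOp, tensorPow_one, Matrix.one_kronecker_one, map_one]

lemma star_tensorOp (A B : Matrix (Fin N) (Fin N) ℂ) :
    star (tensorOp t A B) = tensorOp t Aᴴ Bᴴ := by
  rw [tensorOp, tensorOp, ← map_star, Matrix.star_eq_conjTranspose, Matrix.conjTranspose_kronecker,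
    tensorPow_eq_tens, tensorPow_eq_tens, conjTranspose_tens, conjTranspose_tens]
  rfl

/-- The commutator with a matrix, as an operator on the tensor space. -/
def adOp (M : Matrix (Fin t → Fin N) (Fin t → Fin N) ℂ) : TensorSpace N t →L[ℂ] TensorSpace N t :=
  Matrix.toEuclideanCLM (𝕜 := ℂ) (M ⊗ₖ (1 : Matrix (Fin t → Fin N) (Fin t → Fin N) ℂ) -
    (1 : Matrix (Fin t → Fin N) (Fin t → Fin N) ℂ) ⊗ₖ Mᵀ)

lemma adOp_add (M M' : Matrix (Fin t → Fin N) (Fin t → Fin N) ℂ) :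
    adOp (M + M') = adOp M + adOp M' := by
  rw [adOp, adOp, adOp, ← map_add, Matrix.transpose_add, Matrix.add_kronecker,
    Matrix.kronecker_add]
  congr 1; abel

lemma adOp_smul (c : ℂ) (M : Matrix (Fin t → Fin N) (Fin t → Fin N) ℂ) :
    adOp (c • M) = c • adOp M := by
  rw [adOp, adOp, ← map_smul, Matrix.transpose_smul, Matrix.smul_kronecker,
    Matrix.kronecker_smul, smul_sub]

lemma adOp_one : adOp (1 : Matrix (Fin t → Fin N) (Fin t → Fin N) ℂ) = 0 := by
  rw [adOp, Matrix.transpose_one, sub_self, map_zero]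

lemma sub_kronecker {m n : Type*} (A B : Matrix m m ℂ) (C : Matrix n n ℂ) :
    (A - B) ⊗ₖ C = A ⊗ₖ C - B ⊗ₖ C := by
  ext; simp [sub_mul]

lemma kronecker_sub {m n : Type*} (A : Matrix m m ℂ) (B C : Matrix n n ℂ) :
    A ⊗ₖ (B - C) = A ⊗ₖ B - A ⊗ₖ C := by
  ext; simp [mul_sub]

lemma adOp_mul_sub (M M' : Matrix (Fin t → Fin N) (Fin t → Fin N) ℂ) :
    adOp M * adOp M' - adOp M' * adOp M = adOp (M * M' - M' * M) := by
  simp only [adOp, ← map_mul, ← map_sub]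
  congr 1
  simp only [sub_mul, mul_sub, ← Matrix.mul_kronecker_mul, one_mul, mul_one, Matrix.transpose_sub,
    Matrix.transpose_mul, sub_kronecker, kronecker_sub]
  abel

lemma star_adOp (M : Matrix (Fin t → Fin N) (Fin t → Fin N) ℂ) : star (adOp M) = adOp Mᴴ := by
  rw [adOp, adOp, ← map_star, Matrix.star_eq_conjTranspose, Matrix.conjTranspose_sub,
    Matrix.conjTranspose_kronecker, Matrix.conjTranspose_kronecker, Matrix.conjTranspose_one]
  rfl

lemma inner_adOp (M : Matrix (Fin t → Fin N) (Fin t → Fin N) ℂ) (u v : TensorSpace N t) :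
    ⟪adOp M u, v⟫_ℂ = ⟪u, adOp Mᴴ v⟫_ℂ := by
  rw [← star_adOp, ContinuousLinearMap.star_eq_adjoint, ContinuousLinearMap.adjoint_inner_right]

variable (N t) in
/-- The derivative at the identity of the representation on the tensor space. -/
def liftOp : Matrix (Fin N) (Fin N) ℂ →ₗ[ℂ] TensorSpace N t →L[ℂ] TensorSpace N t where
  toFun A := adOp (deriv N t A)
  map_add' A B := by rw [map_add, adOp_add]
  map_smul' c A := by rw [map_smul, adOp_smul, RingHom.id_apply]

lemma liftOp_apply (A : Matrix (Fin N) (Fin N) ℂ) : liftOp N t A = adOp (deriv N t A) := rfl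

lemma liftOp_one : liftOp N t 1 = 0 := by
  rw [liftOp_apply, deriv_one, adOp_smul, adOp_one]
  exact smul_zero (A := TensorSpace N t →L[ℂ] TensorSpace N t) (t : ℂ)

lemma inner_liftOp (A : Matrix (Fin N) (Fin N) ℂ) (u v : TensorSpace N t) :
    ⟪liftOp N t A u, v⟫_ℂ = ⟪u, liftOp N t Aᴴ v⟫_ℂ := by
  rw [liftOp_apply, liftOp_apply, inner_adOp, conjTranspose_deriv]

lemma liftOp_liftOp (A B : Matrix (Fin N) (Fin N) ℂ) (v : TensorSpace N t) :
    liftOp N t A (liftOp N t B v) = liftOp N t B (liftOp N t A v) +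
      liftOp N t (A * B - B * A) v := by
  rw [liftOp_apply (A * B - B * A), ← deriv_mul_sub, ← adOp_mul_sub]
  exact (add_sub_cancel _ _).symm

/-- For unitary V the conjugate is the transpose of the inverse, so both factors intertwine with the
same conjugation A ↦ V A Vᴴ. -/
lemma tensorOp_liftOp {V : Matrix (Fin N) (Fin N) ℂ} (h : Vᴴ * V = 1)
    (A : Matrix (Fin N) (Fin N) ℂ) (v : TensorSpace N t) :
    tensorOp t V (conjMat V) (liftOp N t A v) =
      liftOp N t (V * A * Vᴴ) (tensorOp t V (conjMat V) v) := by
  have hc : conjMat V = Vᴴᵀ := rfl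
  have h' : Vᵀ * Vᴴᵀ = 1 := by rw [← Matrix.transpose_mul, h, Matrix.transpose_one]
  have : tensorOp t V (conjMat V) * liftOp N t A =
      liftOp N t (V * A * Vᴴ) * tensorOp t V (conjMat V) := by
    rw [hc, liftOp_apply, liftOp_apply, tensorOp, adOp, adOp, ← map_mul, ← map_mul]
    congr 1
    rw [mul_sub, sub_mul, ← Matrix.mul_kronecker_mul, ← Matrix.mul_kronecker_mul,
      ← Matrix.mul_kronecker_mul, ← Matrix.mul_kronecker_mul, mul_one, mul_one, one_mul, one_mul,
      tensorPow_mul_deriv h, transpose_deriv, tensorPow_mul_deriv h', transpose_deriv,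
      Matrix.transpose_mul, Matrix.transpose_mul, mul_assoc, mul_assoc Vᴴᵀ]
  exact congrArg (fun T => T v) this

/-- A matrix as a vector of the tensor space. -/
def vecOf (T : Matrix (Fin t → Fin N) (Fin t → Fin N) ℂ) : TensorSpace N t :=
  WithLp.toLp 2 fun p => T p.1 p.2

/-- This turns `adOp` into the matrix commutator, where highest weight vectors are easy to write
down. -/
lemma kronecker_vecOf (A B T : Matrix (Fin t → Fin N) (Fin t → Fin N) ℂ) :
    Matrix.toEuclideanCLM (𝕜 := ℂ) (A ⊗ₖ B) (vecOf T) = vecOf (A * T * Bᵀ) := by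
  ext p
  simp only [vecOf, Matrix.toEuclideanCLM_toLp, Matrix.mulVec, dotProduct, Fintype.sum_prod_type,
    Matrix.kroneckerMap_apply, Matrix.mul_apply, Matrix.transpose_apply, Finset.sum_mul]
  rw [Finset.sum_comm]
  refine Finset.sum_congr rfl fun i _ => Finset.sum_congr rfl fun j _ => ?_
  ring

lemma adOp_vecOf (M T : Matrix (Fin t → Fin N) (Fin t → Fin N) ℂ) :
    adOp M (vecOf T) = vecOf (M * T - T * M) := by
  rw [adOp, map_sub]
  change Matrix.toEuclideanCLM (𝕜 := ℂ) _ _ - Matrix.toEuclideanCLM (𝕜 := ℂ) _ _ = _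
  rw [kronecker_vecOf, kronecker_vecOf, Matrix.transpose_one, mul_one, one_mul,
    Matrix.transpose_transpose]
  rfl

/-! ### The representation of su(2) on the tensor space. -/

/-- The difference of the numbers of vanishing indices. -/
def wt (p : (Fin t → Fin 2) × (Fin t → Fin 2)) : ℤ :=
  ∑ j, ((if p.1 j = 0 then 1 else 0) - (if p.2 j = 0 then 1 else 0))

lemma abs_wt_le (p : (Fin t → Fin 2) × (Fin t → Fin 2)) : |wt p| ≤ t := by
  refine (Finset.abs_sum_le_sum_abs _ _).trans ?_
  refine (Finset.sum_le_card_nsmul _ _ 1 fun j _ => ?_).trans (by simp)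
  split_ifs <;> simp

lemma deriv_diag : deriv 2 t !![1, 0; 0, 0] =
    Matrix.diagonal fun r => ∑ j, if r j = 0 then 1 else 0 := by
  ext r s
  rw [deriv_apply, Matrix.sum_apply]
  simp only [tens_mulSingle_apply]
  rcases eq_or_ne r s with rfl | h
  · rw [Matrix.diagonal_apply_eq]
    refine Finset.sum_congr rfl fun j _ => ?_
    rw [if_pos (fun _ _ => rfl), one_mul]
    generalize r j = a
    fin_cases a <;> simp
  · rw [Matrix.diagonal_apply_ne _ h]
    refine Finset.sum_eq_zero fun j _ => ?_
    split_ifs with h1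
    · have hj : r j ≠ s j := fun h2 => h (funext fun i => by
        rcases eq_or_ne i j with rfl | hi
        · exact h2
        · exact h1 i hi)
      rw [one_mul]
      generalize r j = a at hj
      generalize s j = b at hj
      fin_cases a <;> fin_cases b <;> simp at hj ⊢
    · rw [zero_mul]

lemma liftOp_diag_apply (v : TensorSpace 2 t) (p) :
    liftOp 2 t !![1, 0; 0, 0] v p = (wt p : ℂ) * v p := by
  have : (deriv 2 t !![1, 0; 0, 0] ⊗ₖ (1 : Matrix (Fin t → Fin 2) (Fin t → Fin 2) ℂ) -
      (1 : Matrix (Fin t → Fin 2) (Fin t → Fin 2) ℂ) ⊗ₖ (deriv 2 t !![1, 0; 0, 0])ᵀ) =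
      Matrix.diagonal fun p => (wt p : ℂ) := by
    rw [deriv_diag, Matrix.diagonal_transpose, ← Matrix.diagonal_one,
      Matrix.diagonal_kronecker_diagonal, Matrix.diagonal_kronecker_diagonal, Matrix.diagonal_sub]
    congr 1
    ext p
    simp [wt, Finset.sum_sub_distrib]
  rw [liftOp_apply, adOp, this, Matrix.ofLp_toEuclideanCLM, Matrix.mulVec_diagonal]

/-- The projection onto the vectors of weight `m`. -/
def weightProj (t : ℕ) (m : ℤ) : TensorSpace 2 t →L[ℂ] TensorSpace 2 t :=
  Matrix.toEuclideanCLM (𝕜 := ℂ) (Matrix.diagonal fun p => if wt p = m then 1 else 0)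

lemma weightProj_apply (m : ℤ) (v : TensorSpace 2 t) (p) :
    weightProj t m v p = if wt p = m then v p else 0 := by
  rw [weightProj, Matrix.ofLp_toEuclideanCLM, Matrix.mulVec_diagonal]
  simp

/-- A rotation which permutes the three axes cyclically. -/
def cycMat : Matrix (Fin 2) (Fin 2) ℂ :=
  (2⁻¹ : ℂ) • !![1 - Complex.I, -1 - Complex.I; 1 - Complex.I, 1 + Complex.I]

lemma conjTranspose_cycMat : cycMatᴴ =
    (2⁻¹ : ℂ) • !![1 + Complex.I, 1 + Complex.I; -1 + Complex.I, 1 - Complex.I] := by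
  ext i j
  fin_cases i <;> fin_cases j <;> (simp [cycMat]; try ring)

lemma star_cycMat_mul : cycMatᴴ * cycMat = 1 := by
  rw [conjTranspose_cycMat, cycMat]
  ext i j
  fin_cases i <;> fin_cases j <;> simp [Matrix.mul_apply, Fin.sum_univ_two] <;>
    first | ring1 | linear_combination (-2⁻¹ : ℂ) * Complex.I_sq

/-- `cycMat` is ½(1 - i(σ^x + σ^y + σ^z)), the rotation by 2π/3 about the diagonal; conjugation
sends z to x, x to y and y to z. -/
lemma cycMat_conj_x : cycMat * !![0, 1; 1, 0] * cycMatᴴ = -Complex.I • !![0, 1; -1, 0] := by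
  rw [conjTranspose_cycMat, cycMat]
  ext i j
  fin_cases i <;> fin_cases j <;> simp [Matrix.mul_apply, Fin.sum_univ_two] <;>
    first | ring1 | linear_combination (2⁻¹ : ℂ) * Complex.I_sq |
      linear_combination (-2⁻¹ : ℂ) * Complex.I_sq

lemma cycMat_conj_y : cycMat * !![0, 1; -1, 0] * cycMatᴴ =
    (2 * Complex.I) • !![1, 0; 0, 0] - Complex.I • 1 := by
  rw [conjTranspose_cycMat, cycMat]
  ext i j
  fin_cases i <;> fin_cases j <;> simp [Matrix.mul_apply, Fin.sum_univ_two] <;>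
    first | ring1 | linear_combination (2⁻¹ : ℂ) * Complex.I_sq |
      linear_combination (-2⁻¹ : ℂ) * Complex.I_sq

lemma cycMat_conj_z : cycMat * ((2 : ℂ) • !![1, 0; 0, 0]) * cycMatᴴ = !![0, 1; 1, 0] + 1 := by
  rw [conjTranspose_cycMat, cycMat]
  ext i j
  fin_cases i <;> fin_cases j <;> simp [Matrix.mul_apply, Fin.sum_univ_two] <;>
    first | ring1 | linear_combination (-2⁻¹ : ℂ) * Complex.I_sq

lemma liftOp_x (v : TensorSpace 2 t) : liftOp 2 t !![0, 1; 1, 0] v =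
    liftOp 2 t !![0, 1; 0, 0] v + liftOp 2 t !![0, 0; 1, 0] v := by
  rw [← add_apply, ← map_add]
  congr 2
  ext i j; fin_cases i <;> fin_cases j <;> simp

lemma liftOp_y (v : TensorSpace 2 t) : liftOp 2 t !![0, 1; -1, 0] v =
    liftOp 2 t !![0, 1; 0, 0] v - liftOp 2 t !![0, 0; 1, 0] v := by
  rw [← sub_apply, ← map_sub]
  congr 2
  ext i j; fin_cases i <;> fin_cases j <;> simp

lemma tensorOp_mem_unitary {U : Matrix (Fin 2) (Fin 2) ℂ} (h : Uᴴ * U = 1) :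
    tensorOp t U (conjMat U) ∈ unitary (TensorSpace 2 t →L[ℂ] TensorSpace 2 t) := by
  have h' : U * Uᴴ = 1 := mul_eq_one_comm.1 h
  have e : conjMat U = Uᴴᵀ := rfl
  have e' : Uᴴᵀᴴ = Uᵀ := by ext; simp
  rw [Unitary.mem_iff, star_tensorOp, tensorOp_mul, tensorOp_mul, h, h', e, e',
    ← Matrix.transpose_mul, ← Matrix.transpose_mul, h, h', Matrix.transpose_one, tensorOp_one]
  exact ⟨rfl, rfl⟩

/-- The rotation which permutes the three axes cyclically, on the tensor space. -/
def cycOp (t : ℕ) : TensorSpace 2 t ≃ₗᵢ[ℂ] TensorSpace 2 t :=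
  Unitary.linearIsometryEquiv ⟨_, tensorOp_mem_unitary star_cycMat_mul⟩

lemma cycOp_apply (v : TensorSpace 2 t) : cycOp t v = tensorOp t cycMat (conjMat cycMat) v := rfl

lemma cycOp_liftOp {A B : Matrix (Fin 2) (Fin 2) ℂ} (h : cycMat * A * cycMatᴴ = B)
    (v : TensorSpace 2 t) : cycOp t (liftOp 2 t A v) = liftOp 2 t B (cycOp t v) := by
  rw [cycOp_apply, tensorOp_liftOp star_cycMat_mul, h, cycOp_apply]

lemma liftOp_of_eq_zero {v : TensorSpace 2 t} {m : ℂ}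
    {p} (h : liftOp 2 t !![1, 0; 0, 0] v = m • v) (hp : (wt p : ℂ) ≠ m) : v p = 0 := by
  have h1 : ((wt p : ℂ) - m) * v p = 0 := by
    have h2 := congrArg (fun w => w p) h
    change liftOp 2 t !![1, 0; 0, 0] v p = m * v p at h2
    rw [liftOp_diag_apply] at h2
    rw [sub_mul, h2, sub_self]
  exact (mul_eq_zero.1 h1).resolve_left (sub_ne_zero.2 hp)

/-- The representation of `su(2)` on the tensor space. -/
def spinRep (t : ℕ) : SpinRep (TensorSpace 2 t) t where
  -- Scalar matrices act as zero, so this matrix unit acts as σ^z/2, and its weights are visibly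
  -- integers.
  Jz := liftOp 2 t !![1, 0; 0, 0]
  Jp := liftOp 2 t !![0, 1; 0, 0]
  Jm := liftOp 2 t !![0, 0; 1, 0]
  Q := weightProj t
  R := cycOp t
  inner_Jz u v := by
    rw [inner_liftOp]
    congr 3
    ext i j; fin_cases i <;> fin_cases j <;> simp
  inner_Jp u v := by
    rw [inner_liftOp]
    congr 3
    ext i j; fin_cases i <;> fin_cases j <;> simp
  Jz_Jp v := by
    rw [liftOp_liftOp]
    congr 3
    ext i j; fin_cases i <;> fin_cases j <;> simp
  Jz_Jm v := by
    rw [liftOp_liftOp, sub_eq_add_neg (liftOp 2 t _ _)]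
    congr 1
    rw [← neg_apply, ← map_neg]
    congr 2
    ext i j; fin_cases i <;> fin_cases j <;> simp
  Jp_Jm v := by
    rw [liftOp_liftOp]
    congr 1
    rw [show (!![0, 1; 0, 0] * !![0, 0; 1, 0] - !![0, 0; 1, 0] * !![0, 1; 0, 0] :
      Matrix (Fin 2) (Fin 2) ℂ) = (2 : ℂ) • !![1, 0; 0, 0] - 1 by
        ext i j; fin_cases i <;> fin_cases j <;> norm_num [Matrix.one_apply], map_sub, map_smul,
      liftOp_one, sub_zero]
    rfl
  Jz_Q m v := by
    ext p
    change _ = (m : ℂ) * weightProj t m v p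
    rw [liftOp_diag_apply, weightProj_apply]
    split_ifs with h
    · rw [h]
    · simp
  Q_of_eq m v h := by
    ext p
    rw [weightProj_apply]
    split_ifs with hp
    · rfl
    · exact (liftOp_of_eq_zero h (by exact_mod_cast hp)).symm
  Q_of_ne m n v h hn := by
    ext p
    rw [weightProj_apply]
    split_ifs with hp
    · exact liftOp_of_eq_zero h (by rw [hp]; exact_mod_cast hn)
    · rfl
  sum_Q v := by
    ext p
    rw [WithLp.ofLp_sum, Finset.sum_apply]
    simp only [weightProj_apply]
    rw [Finset.sum_ite_eq, if_pos]
    rw [Finset.mem_Icc, ← abs_le]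
    exact abs_wt_le p
  Q_of_lt m v h := by
    ext p
    rw [weightProj_apply, if_neg]
    · rfl
    · rintro rfl
      exact (abs_wt_le p).not_gt h
  R_Jx v := by
    rw [← liftOp_x, ← liftOp_y, cycOp_liftOp cycMat_conj_x, map_smul]
    rfl
  R_Jy v := by
    rw [← liftOp_y, cycOp_liftOp cycMat_conj_y, map_sub, map_smul, map_smul, liftOp_one]
    simp
  R_Jz v := by
    rw [← map_smul, ← smul_apply, ← map_smul, cycOp_liftOp cycMat_conj_z, map_add, liftOp_one,
      add_zero, liftOp_x]

/-- Take the matrix with E₁₂ in the first k slots and 1 elsewhere: it commutes with E₁₂ in every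
slot, and the commutator with E₁₁ counts the k slots. -/
lemma exists_highest_weight {k : ℕ} (hk : k ≤ t) :
    ∃ v ≠ 0, (spinRep t).Jz v = (k : ℂ) • v ∧ (spinRep t).Jp v = 0 := by
  set f : Fin t → Matrix (Fin 2) (Fin 2) ℂ := fun j => if (j : ℕ) < k then !![0, 1; 0, 0] else 1
    with hf
  refine ⟨vecOf (tens f), ?_, ?_, ?_⟩
  · intro h
    have h1 := congrArg (fun w => w (0, fun j => if (j : ℕ) < k then 1 else 0)) h
    change tens f 0 (fun j => if (j : ℕ) < k then 1 else 0) = 0 at h1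
    rw [tens_apply, Finset.prod_eq_zero_iff] at h1
    obtain ⟨j, -, hj⟩ := h1
    rw [hf] at hj
    by_cases hjk : (j : ℕ) < k <;> simp [hjk, Matrix.one_apply] at hj
  · change adOp (deriv 2 t !![1, 0; 0, 0]) (vecOf (tens f)) = _
    rw [adOp_vecOf]
    have : deriv 2 t !![1, 0; 0, 0] * tens f - tens f * deriv 2 t !![1, 0; 0, 0] =
        (k : ℂ) • tens f := by
      rw [deriv_apply, Finset.sum_mul, Finset.mul_sum, ← Finset.sum_sub_distrib]
      rw [Finset.sum_congr rfl (g := fun j : Fin t => if (j : ℕ) < k then tens f else 0)]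
      · rw [← Finset.sum_filter, Finset.sum_const, Nat.cast_smul_eq_nsmul]
        congr 1
        simp [Fin.card_filter_val_lt, hk]
      · intro j _
        rw [tens_mul, tens_mul]
        split_ifs with hjk
        -- E₁₂ E₁₁ = 0, while E₁₁ E₁₂ = E₁₂.
        · rw [tens_eq_zero (f := f * _) j, sub_zero]
          · congr 1
            ext1 i
            rcases eq_or_ne i j with rfl | hij
            · ext a b
              fin_cases a <;> fin_cases b <;> simp [hf, hjk]
            · simp [Pi.mulSingle_eq_of_ne hij]
          · ext a b
            fin_cases a <;> fin_cases b <;> simp [hf, hjk]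
        · rw [sub_eq_zero]
          congr 1
          ext1 i
          rcases eq_or_ne i j with rfl | hij
          · simp [hf, hjk]
          · simp [Pi.mulSingle_eq_of_ne hij]
    rw [this]
    rfl
  · change adOp (deriv 2 t !![0, 1; 0, 0]) (vecOf (tens f)) = _
    rw [adOp_vecOf, deriv_apply, Finset.sum_mul, Finset.mul_sum, ← Finset.sum_sub_distrib,
      Finset.sum_eq_zero]
    · rfl
    · intro j _
      rw [tens_mul, tens_mul, sub_eq_zero]
      congr 1
      ext1 i
      rcases eq_or_ne i j with rfl | hij
      · by_cases hjk : (i : ℕ) < k <;> simp [hf, hjk]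
      · simp [Pi.mulSingle_eq_of_ne hij]

/-! ### Rotations and the average over the three axes. -/

/-- The action of a matrix on the tensor space. -/
def rho (t : ℕ) (U : Matrix (Fin 2) (Fin 2) ℂ) : TensorSpace 2 t →L[ℂ] TensorSpace 2 t :=
  tensorOp t U (conjMat U)

lemma conjMat_eq (U : Matrix (Fin 2) (Fin 2) ℂ) : conjMat U = Uᴴᵀ := rfl

lemma rho_mul (U V : Matrix (Fin 2) (Fin 2) ℂ) : rho t (U * V) = rho t U * rho t V := by
  rw [rho, rho, rho, tensorOp_mul, conjMat_eq, conjMat_eq, conjMat_eq, Matrix.conjTranspose_mul,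
    Matrix.transpose_mul]

lemma rho_one : rho t 1 = 1 := by
  rw [rho, conjMat_eq, Matrix.conjTranspose_one, Matrix.transpose_one, tensorOp_one]

lemma rho_cycMat (v : TensorSpace 2 t) : rho t cycMat v = (spinRep t).R v := rfl

lemma rho_star_cycMat (v : TensorSpace 2 t) : rho t cycMatᴴ v = (spinRep t).R.symm v := by
  rw [LinearIsometryEquiv.eq_symm_apply, ← rho_cycMat]
  change (rho t cycMat * rho t cycMatᴴ) v = v
  rw [← rho_mul, mul_eq_one_comm.1 star_cycMat_mul, rho_one]
  rfl

lemma inner_rho_rho {U : Matrix (Fin 2) (Fin 2) ℂ} (h : Uᴴ * U = 1) (u v : TensorSpace 2 t) :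
    ⟪rho t U u, rho t U v⟫_ℂ = ⟪u, v⟫_ℂ :=
  Unitary.inner_map_map ⟨_, tensorOp_mem_unitary h⟩ u v

/-- The rotation about the third axis. -/
def rotMat (x : ℝ) : Matrix (Fin 2) (Fin 2) ℂ :=
  Matrix.diagonal ![Complex.exp (x * Complex.I), Complex.exp (-(x * Complex.I))]

lemma rho_rotMat_apply (x : ℝ) (v : TensorSpace 2 t) (p) :
    rho t (rotMat x) v p = Complex.exp (2 * x * wt p * Complex.I) * v p := by
  have hd : ∀ d : Fin 2 → ℂ, tensorPow t (Matrix.diagonal d) =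
      Matrix.diagonal fun r : Fin t → Fin 2 => ∏ j, d (r j) := by
    intro d
    ext r s
    rcases eq_or_ne r s with rfl | h
    · simp [tensorPow]
    · obtain ⟨j, hj⟩ := Function.ne_iff.1 h
      rw [Matrix.diagonal_apply_ne _ h]
      exact Finset.prod_eq_zero (Finset.mem_univ j) (Matrix.diagonal_apply_ne _ hj)
  have hc : conjMat (rotMat x) =
      Matrix.diagonal ![Complex.exp (-(x * Complex.I)), Complex.exp (x * Complex.I)] := by
    ext i j
    fin_cases i <;> fin_cases j <;> simp [conjMat, rotMat, ← Complex.exp_conj]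
  rw [rho, hc, rotMat, tensorOp, hd, hd, Matrix.diagonal_kronecker_diagonal,
    Matrix.ofLp_toEuclideanCLM, Matrix.mulVec_diagonal, ← Finset.prod_mul_distrib]
  congr 1
  rw [wt, Int.cast_sum, Finset.mul_sum, Finset.sum_mul, Complex.exp_sum]
  refine Finset.prod_congr rfl fun j _ => ?_
  generalize p.1 j = a
  generalize p.2 j = b
  fin_cases a <;> fin_cases b <;> simp [← Complex.exp_add] <;> ring_nf

lemma rho_rotMat_of_Jz {v : TensorSpace 2 t} (h : (spinRep t).Jz v = 0) (x : ℝ) :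
    rho t (rotMat x) v = v := by
  ext p
  rw [rho_rotMat_apply]
  by_cases hp : wt p = 0
  · simp [hp]
  · have : v p = 0 := liftOp_of_eq_zero (m := 0) (by rw [zero_smul]; exact h)
      (by exact_mod_cast hp)
    rw [this, mul_zero]

lemma Jz_of_rho_rotMat {v : TensorSpace 2 t} (h : ∀ x, rho t (rotMat x) v = v) :
    (spinRep t).Jz v = 0 := by
  ext p
  change liftOp 2 t !![1, 0; 0, 0] v p = 0
  rw [liftOp_diag_apply]
  by_cases hp : wt p = 0
  · simp [hp]
  · have hp' : (wt p : ℂ) ≠ 0 := by exact_mod_cast hp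
    -- At this angle the character of the weight `wt p` equals -1.
    have h1 := congrArg (fun w => w p) (h (Real.pi / (2 * wt p)))
    simp only [rho_rotMat_apply] at h1
    have h2 : (2 * ((Real.pi / (2 * wt p) : ℝ) : ℂ) * wt p * Complex.I) = Real.pi * Complex.I := by
      push_cast
      field_simp
    rw [h2, Complex.exp_pi_mul_I, neg_one_mul] at h1
    rw [self_eq_neg.1 h1.symm, mul_zero]

lemma continuous_tensorPow : Continuous (tensorPow t : Matrix (Fin 2) (Fin 2) ℂ → _) := by
  refine continuous_matrix fun r s => ?_
  change Continuous fun A : Matrix (Fin 2) (Fin 2) ℂ => ∏ j, A (r j) (s j)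
  exact continuous_finsetProd _ fun j _ => continuous_id.matrix_elem (r j) (s j)

lemma continuous_rho : Continuous (rho t) := by
  have h : Continuous fun M : Matrix ((Fin t → Fin 2) × (Fin t → Fin 2))
      ((Fin t → Fin 2) × (Fin t → Fin 2)) ℂ => Matrix.toEuclideanCLM (𝕜 := ℂ) M :=
    LinearMap.continuous_of_finiteDimensional
      { toFun := fun M => Matrix.toEuclideanCLM (𝕜 := ℂ) M
        map_add' := map_add _
        map_smul' := map_smul _ }
  refine h.comp (continuous_matrix fun r s => ?_)
  exact (continuous_tensorPow.matrix_elem _ _).mul ((continuous_tensorPow.comp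
    (continuous_id.matrix_map Complex.continuous_conj)).matrix_elem _ _)

/-- Evaluation of an operator at a vector and of the result in a coordinate. -/
def evalCLM (v : TensorSpace 2 t) (p : (Fin t → Fin 2) × (Fin t → Fin 2)) :
    (TensorSpace 2 t →L[ℂ] TensorSpace 2 t) →L[ℂ] ℂ :=
  EuclideanSpace.proj p ∘L ContinuousLinearMap.apply ℂ (TensorSpace 2 t) v

lemma evalCLM_apply (v : TensorSpace 2 t) (p) (T : TensorSpace 2 t →L[ℂ] TensorSpace 2 t) :
    evalCLM v p T = T v p := rfl

instance : IsProbabilityMeasure uniformAngle :=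
  ProbabilityTheory.cond_isProbabilityMeasure_of_finite (by simp [Real.pi_pos]) (by simp)

lemma integrable_uniformAngle {F : Type*} [NormedAddCommGroup F] {f : ℝ → F}
    (hf : Continuous f) : Integrable f uniformAngle := by
  refine Integrable.smul_measure ?_ (by simp [Real.pi_pos])
  exact (hf.integrableOn_Icc (a := -Real.pi) (b := Real.pi)).mono_set Set.Ioo_subset_Icc_self

lemma integral_exp_uniformAngle (m : ℤ) :
    ∫ x, Complex.exp (x * m * Complex.I) ∂uniformAngle = if m = 0 then 1 else 0 := by
  split_ifs with h
  · simp [h]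
  · rw [uniformAngle, ProbabilityTheory.cond, integral_smul_measure,
      ← integral_Ioc_eq_integral_Ioo, ← intervalIntegral.integral_of_le (by linarith [Real.pi_pos])]
    have hm : (m : ℂ) * Complex.I ≠ 0 := mul_ne_zero (by exact_mod_cast h) Complex.I_ne_zero
    have h1 := integral_exp_mul_complex (a := -Real.pi) (b := Real.pi) hm
    have h2 : Complex.exp (m * Complex.I * (Real.pi : ℝ)) =
        Complex.exp (m * Complex.I * (-Real.pi : ℝ)) := by
      rw [Complex.exp_eq_exp_iff_exists_int]
      exact ⟨m, by push_cast; ring⟩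
    rw [h2, sub_self, zero_div] at h1
    have h3 : ∫ x : ℝ in -Real.pi..Real.pi, Complex.exp (x * m * Complex.I) = 0 := by
      rw [← h1]
      congr 1
      ext x
      ring_nf
    rw [h3, smul_zero]

lemma continuous_rotMat : Continuous rotMat := by
  refine Continuous.matrix_diagonal (continuous_pi fun i => ?_)
  fin_cases i <;> simp <;> fun_prop

/-- At half the angle, weight m contributes exp(ixm), whose mean over a full period vanishes unless
m = 0. -/
lemma integral_rho_rotMat :
    ∫ x, rho t (rotMat (x / 2)) ∂uniformAngle = weightProj t 0 := by
  have hi : Integrable (fun x => rho t (rotMat (x / 2))) uniformAngle :=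
    integrable_uniformAngle (continuous_rho.comp (continuous_rotMat.comp (by fun_prop)))
  ext v p
  rw [← evalCLM_apply, ← ContinuousLinearMap.integral_comp_comm _ hi]
  simp only [evalCLM_apply, rho_rotMat_apply]
  rw [integral_mul_const, weightProj_apply]
  have : ∀ x : ℝ, 2 * ((x / 2 : ℝ) : ℂ) * wt p * Complex.I = x * wt p * Complex.I := by
    intro x; push_cast; ring
  simp only [this, integral_exp_uniformAngle]
  split_ifs <;> simp

section

attribute [local instance] Matrix.linftyOpNormedRing Matrix.linftyOpNormedAlgebra

lemma continuous_exp_matrix :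
    Continuous (NormedSpace.exp : Matrix (Fin 2) (Fin 2) ℂ → Matrix (Fin 2) (Fin 2) ℂ) :=
  NormedSpace.exp_continuous

end

lemma exp_conjMat (X : Matrix (Fin 2) (Fin 2) ℂ) :
    NormedSpace.exp (-(Complex.I • conjMat X)) = conjMat (NormedSpace.exp (Complex.I • X)) := by
  rw [conjMat_eq, conjMat_eq, ← Matrix.exp_conjTranspose, ← Matrix.exp_transpose]
  congr 1
  ext; simp

lemma exp_sigmaZ (x : ℝ) : NormedSpace.exp (Complex.I • ((x • sigmaZ : su 2) :
    Matrix (Fin 2) (Fin 2) ℂ)) = rotMat x := by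
  have : Complex.I • ((x • sigmaZ : su 2) : Matrix (Fin 2) (Fin 2) ℂ) =
      Matrix.diagonal ![x * Complex.I, -(x * Complex.I)] := by
    ext i j
    fin_cases i <;> fin_cases j <;> simp [sigmaZ, mul_comm]
  rw [this, Matrix.exp_diagonal, rotMat]
  congr 1
  ext i
  fin_cases i <;> simp [Complex.exp_eq_exp_ℂ, Pi.coe_exp]

lemma exp_conj_of_unitary {U : Matrix (Fin 2) (Fin 2) ℂ} (hU : Uᴴ * U = 1) {P Q : su 2}
    (h : U * P * Uᴴ = (Q : Matrix (Fin 2) (Fin 2) ℂ)) (x : ℝ) :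
    NormedSpace.exp (Complex.I • ((x • Q : su 2) : Matrix (Fin 2) (Fin 2) ℂ)) =
      U * NormedSpace.exp (Complex.I • ((x • P : su 2) : Matrix (Fin 2) (Fin 2) ℂ)) * Uᴴ := by
  have hinv : U⁻¹ = Uᴴ := Matrix.inv_eq_left_inv hU
  have hu : IsUnit U := IsUnit.of_mul_eq_one_right _ hU
  rw [← hinv, ← Matrix.exp_conj _ _ hu, hinv]
  congr 1
  simp only [Submodule.coe_smul, ← h, mul_smul_comm, smul_mul_assoc]

lemma cycMat_conj_sigmaZ : cycMat * sigmaZ * cycMatᴴ = (sigmaX : Matrix (Fin 2) (Fin 2) ℂ) := by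
  rw [conjTranspose_cycMat, cycMat]
  ext i j
  fin_cases i <;> fin_cases j <;> simp [Matrix.mul_apply, Fin.sum_univ_two, sigmaZ, sigmaX] <;>
    first | ring1 | linear_combination (2⁻¹ : ℂ) * Complex.I_sq |
      linear_combination (-2⁻¹ : ℂ) * Complex.I_sq

lemma star_cycMat_conj_sigmaZ :
    cycMatᴴ * sigmaZ * cycMatᴴᴴ = (sigmaY : Matrix (Fin 2) (Fin 2) ℂ) := by
  rw [Matrix.conjTranspose_conjTranspose, conjTranspose_cycMat, cycMat]
  ext i j
  fin_cases i <;> fin_cases j <;> simp [Matrix.mul_apply, Fin.sum_univ_two, sigmaZ, sigmaY] <;>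
    first | ring1 | linear_combination (2⁻¹ : ℂ) * Complex.I_sq |
      linear_combination (-2⁻¹ : ℂ) * Complex.I_sq

/-- The integrand of the moment operator. -/
def momentFun (t : ℕ) (X : su 2) : TensorSpace 2 t →L[ℂ] TensorSpace 2 t :=
  rho t (NormedSpace.exp (Complex.I • (X : Matrix (Fin 2) (Fin 2) ℂ)))

lemma continuous_momentFun : Continuous (momentFun t) :=
  continuous_rho.comp (continuous_exp_matrix.comp (continuous_subtype_val.const_smul Complex.I))

lemma momentOp_eq (μ : Measure (su 2)) : momentOp μ t = ∫ X, momentFun t X ∂μ := by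
  simp only [momentOp, exp_conjMat]
  rfl

lemma continuous_smul_su (P : su 2) : Continuous fun x : ℝ => (x / 2) • P := by
  fun_prop

lemma integrable_momentFun (P : su 2) : Integrable (momentFun t) (rotationBy P) := by
  rw [rotationBy, integrable_map_measure continuous_momentFun.aestronglyMeasurable
    (continuous_smul_su P).aemeasurable]
  exact integrable_uniformAngle (continuous_momentFun.comp (continuous_smul_su P))

lemma integral_rotationBy (P : su 2) : ∫ X, momentFun t X ∂(rotationBy P) =
    ∫ x, momentFun t ((x / 2) • P) ∂uniformAngle := by
  rw [rotationBy, integral_map (continuous_smul_su P).aemeasurable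
    continuous_momentFun.aestronglyMeasurable]

lemma integral_momentFun_sigmaZ :
    ∫ X, momentFun t X ∂(rotationBy sigmaZ) = weightProj t 0 := by
  rw [integral_rotationBy]
  simp only [momentFun, exp_sigmaZ]
  exact integral_rho_rotMat

lemma integral_momentFun_of_conj {U : Matrix (Fin 2) (Fin 2) ℂ} (hU : Uᴴ * U = 1) {Q : su 2}
    (h : U * sigmaZ * Uᴴ = (Q : Matrix (Fin 2) (Fin 2) ℂ)) :
    ∫ X, momentFun t X ∂(rotationBy Q) = rho t U * weightProj t 0 * rho t Uᴴ := by
  rw [integral_rotationBy, ← integral_momentFun_sigmaZ, integral_rotationBy]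
  simp only [momentFun, exp_conj_of_unitary hU h, rho_mul]
  have hi : Integrable (fun x : ℝ => momentFun t ((x / 2) • sigmaZ)) uniformAngle :=
    integrable_uniformAngle (continuous_momentFun.comp (continuous_smul_su sigmaZ))
  exact (ContinuousLinearMap.mulLeftRight ℂ _ (rho t U) (rho t Uᴴ)).integral_comp_comm hi

lemma momentOp_eq_avg : momentOp (randomRotation ![sigmaX, sigmaY, sigmaZ]
    (PMF.uniformOfFintype (Fin 3))) t = (spinRep t).avg := by
  rw [momentOp_eq, randomRotation, integral_finsetSum_measure]
  · simp only [integral_smul_measure, Fin.sum_univ_three, PMF.uniformOfFintype_apply,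
      Matrix.cons_val_zero, Matrix.cons_val_one, Matrix.cons_val_two]
    have e1 := integral_momentFun_of_conj (t := t) star_cycMat_mul cycMat_conj_sigmaZ
    have e2 := integral_momentFun_of_conj (t := t)
      (by rw [Matrix.conjTranspose_conjTranspose, mul_eq_one_comm.1 star_cycMat_mul])
      star_cycMat_conj_sigmaZ
    change _ • (∫ X, momentFun t X ∂(rotationBy sigmaX)) +
      _ • (∫ X, momentFun t X ∂(rotationBy sigmaY)) +
      _ • (∫ X, momentFun t X ∂(rotationBy sigmaZ)) = _
    rw [e1, e2, integral_momentFun_sigmaZ]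
    ext1 v
    rw [SpinRep.avg_apply, SpinRep.projX_apply, SpinRep.projY_apply, ← rho_star_cycMat,
      ← rho_star_cycMat, ← rho_cycMat, ← rho_cycMat]
    have hr : ∀ w : TensorSpace 2 t, (3 : ℝ)⁻¹ • w = (3 : ℂ)⁻¹ • w := fun w => by
      rw [← Complex.coe_smul, Complex.ofReal_inv, Complex.ofReal_ofNat]
    simp [hr]
    rfl
  · intro k _
    exact (integrable_momentFun _).smul_measure (by simp)

/-! ### Invariant vectors and the Haar average. -/

lemma star_mul_of_mem (U : SU 2) : (U : Matrix (Fin 2) (Fin 2) ℂ)ᴴ * U = 1 :=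
  Matrix.mem_unitaryGroup_iff'.1 (Matrix.mem_specialUnitaryGroup_iff.1 U.2).1

lemma star_eq_adjugate (U : SU 2) :
    (U : Matrix (Fin 2) (Fin 2) ℂ)ᴴ = (U : Matrix (Fin 2) (Fin 2) ℂ).adjugate := by
  have h := Matrix.adjugate_mul (U : Matrix (Fin 2) (Fin 2) ℂ)
  rw [(Matrix.mem_specialUnitaryGroup_iff.1 U.2).2, one_smul] at h
  rw [← one_mul (U : Matrix (Fin 2) (Fin 2) ℂ)ᴴ, ← h, mul_assoc,
    mul_eq_one_comm.1 (star_mul_of_mem U), mul_one]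

lemma rotMat_eq (x : ℝ) : rotMat x =
    !![Complex.exp (x * Complex.I), 0; 0, Complex.exp (-(x * Complex.I))] := by
  ext i j
  fin_cases i <;> fin_cases j <;> simp [rotMat]

lemma cycMat_conj_rotMat (x : ℝ) : cycMat * rotMat x * cycMatᴴ =
    !![(Real.cos x : ℂ), Real.sin x * Complex.I; Real.sin x * Complex.I, Real.cos x] := by
  rw [conjTranspose_cycMat, cycMat, rotMat_eq, neg_mul_eq_neg_mul, Complex.exp_mul_I,
    Complex.exp_mul_I, Complex.cos_neg, Complex.sin_neg, Complex.ofReal_cos, Complex.ofReal_sin]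
  ext i j
  fin_cases i <;> fin_cases j <;> simp [Matrix.mul_apply, Fin.sum_univ_two] <;> ring_nf <;>
    simp only [Complex.I_sq, Complex.I_pow_three] <;> ring

lemma rotMat_mul_mul (x z : ℝ) (a b c d : ℂ) : rotMat x * !![a, b; c, d] * rotMat z =
    !![a * Complex.exp ((x + z : ℝ) * Complex.I), b * Complex.exp ((x - z : ℝ) * Complex.I);
      c * Complex.exp (-((x - z : ℝ) * Complex.I)),
      d * Complex.exp (-((x + z : ℝ) * Complex.I))] := by
  have h1 : ((x + z : ℝ) * Complex.I : ℂ) = x * Complex.I + z * Complex.I := by push_cast; ring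
  have h2 : ((x - z : ℝ) * Complex.I : ℂ) = x * Complex.I + -(z * Complex.I) := by push_cast; ring
  rw [h1, h2, neg_add, neg_add, neg_neg, rotMat_eq, rotMat_eq]
  simp only [Complex.exp_add]
  ext i j
  fin_cases i <;> fin_cases j <;> simp [Matrix.mul_apply, Fin.sum_univ_two] <;> ring

lemma exists_euler (U : SU 2) : ∃ x y z : ℝ, (U : Matrix (Fin 2) (Fin 2) ℂ) =
    rotMat x * (cycMat * rotMat y * cycMatᴴ) * rotMat z := by
  set a := (U : Matrix (Fin 2) (Fin 2) ℂ) 0 0 with ha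
  set b := (U : Matrix (Fin 2) (Fin 2) ℂ) 0 1 with hb
  have hstar := star_eq_adjugate U
  have h1 : starRingEnd ℂ a = (U : Matrix (Fin 2) (Fin 2) ℂ) 1 1 := by
    have := congrFun (congrFun hstar 0) 0
    simpa [Matrix.adjugate_fin_two] using this
  have h2 : starRingEnd ℂ b = -(U : Matrix (Fin 2) (Fin 2) ℂ) 1 0 := by
    have := congrFun (congrFun hstar 1) 0
    simpa [Matrix.adjugate_fin_two] using this
  have hdet := (Matrix.mem_specialUnitaryGroup_iff.1 U.2).2
  rw [Matrix.det_fin_two, ← h1, ← ha, ← hb, eq_neg_iff_add_eq_zero.1 h2 |> eq_neg_of_add_eq_zero_right,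
    mul_neg, sub_neg_eq_add, Complex.mul_conj, Complex.mul_conj, Complex.normSq_eq_norm_sq,
    Complex.normSq_eq_norm_sq] at hdet
  have hn : ‖a‖ ^ 2 + ‖b‖ ^ 2 = 1 := by exact_mod_cast hdet
  obtain ⟨y, hc, hs⟩ : ∃ y : ℝ, Real.cos y = ‖a‖ ∧ Real.sin y = ‖b‖ := by
    refine ⟨Real.arccos ‖a‖, Real.cos_arccos (by linarith [norm_nonneg a]) ?_, ?_⟩
    · nlinarith [sq_nonneg ‖b‖]
    · rw [Real.sin_arccos, ← hn, add_sub_cancel_left, Real.sqrt_sq (norm_nonneg b)]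
  have pa := Complex.norm_mul_exp_arg_mul_I a
  have pb := Complex.norm_mul_exp_arg_mul_I b
  set p := a.arg
  set q := b.arg - Real.pi / 2
  have pb' : ‖b‖ * Complex.I * Complex.exp (q * Complex.I) = b := by
    have hq : (q : ℂ) * Complex.I = b.arg * Complex.I - Real.pi / 2 * Complex.I := by
      simp only [q]; push_cast; ring
    rw [hq, Complex.exp_sub, Complex.exp_pi_div_two_mul_I]
    refine Eq.trans ?_ pb
    field_simp
  -- The first row of the product is cos y · exp(i(x + z)), i sin y · exp(i(x - z)); the shift by
  -- π/2 in `q` absorbs the factor i.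
  refine ⟨(p + q) / 2, y, (p - q) / 2, ?_⟩
  have ca := congrArg (starRingEnd ℂ) pa
  have cb := congrArg (starRingEnd ℂ) pb'
  simp only [map_mul, ← Complex.exp_conj, Complex.conj_ofReal, Complex.conj_I] at ca cb
  rw [cycMat_conj_rotMat, hc, hs, rotMat_mul_mul, show (p + q) / 2 + (p - q) / 2 = p by ring,
    show (p + q) / 2 - (p - q) / 2 = q by ring, pa, pb', Matrix.eta_fin_two (U : Matrix _ _ ℂ)]
  congr
  · rw [← neg_eq_iff_eq_neg.2 h2, ← cb]
    simp
  · rw [← h1, ← ca]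
    simp

/-- By Euler angles it suffices to treat rotations about the third axis and their conjugates by
`cycMat`; the kernel of the Casimir operator is stable under the latter and killed by `Jz`. -/
lemma rho_of_cas {v : TensorSpace 2 t} (h : (spinRep t).cas v = 0) (U : SU 2) :
    rho t (U : Matrix (Fin 2) (Fin 2) ℂ) v = v := by
  obtain ⟨x, y, z, hU⟩ := exists_euler U
  have hr : ∀ w, (spinRep t).cas w = 0 → ∀ x, rho t (rotMat x) w = w := fun w hw x =>
    rho_rotMat_of_Jz ((spinRep t).J_eq_zero_of_cas hw).2.2 x
  rw [hU, rho_mul, rho_mul, rho_mul, rho_mul]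
  change rho t (rotMat x) (rho t cycMat (rho t (rotMat y) (rho t cycMatᴴ (rho t (rotMat z) v)))) = v
  rw [hr v h, rho_star_cycMat, hr ((spinRep t).R.symm v) (by rw [SpinRep.cas_R_symm, h, map_zero]), rho_cycMat,
    LinearIsometryEquiv.apply_symm_apply, hr v h]

lemma rotMat_mem (x : ℝ) : rotMat x ∈ Matrix.specialUnitaryGroup (Fin 2) ℂ := by
  rw [Matrix.mem_specialUnitaryGroup_iff, Matrix.mem_unitaryGroup_iff']
  constructor
  · rw [rotMat, Matrix.star_eq_conjTranspose, Matrix.diagonal_conjTranspose,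
      Matrix.diagonal_mul_diagonal, ← Matrix.diagonal_one]
    congr 1
    ext i
    fin_cases i <;> simp [← Complex.exp_conj, ← Complex.exp_add]
  · simp [rotMat, ← Complex.exp_add]

lemma cycMat_mem : cycMat ∈ Matrix.specialUnitaryGroup (Fin 2) ℂ := by
  rw [Matrix.mem_specialUnitaryGroup_iff, Matrix.mem_unitaryGroup_iff']
  refine ⟨star_cycMat_mul, ?_⟩
  simp [cycMat, Matrix.det_fin_two]
  linear_combination (-2⁻¹ : ℂ) * Complex.I_sq

/-- Invariance under the third axis gives J_z v = 0, and invariance under the cyclic rotation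
carries this to the other two axes. -/
lemma cas_of_rho {v : TensorSpace 2 t}
    (h : ∀ U : SU 2, rho t (U : Matrix (Fin 2) (Fin 2) ℂ) v = v) : (spinRep t).cas v = 0 := by
  have hz : (spinRep t).Jz v = 0 := Jz_of_rho_rotMat fun x => h ⟨_, rotMat_mem x⟩
  have hR : (spinRep t).R v = v := h ⟨_, cycMat_mem⟩
  have hx := (spinRep t).R_of_Jz hz
  have hy := (spinRep t).R_of_Jx (hR ▸ hx)
  rw [hR] at hx hy
  have hp : (2 : ℂ) • (spinRep t).Jp v = 0 := by
    rw [← add_zero (0 : TensorSpace 2 t)]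
    nth_rw 1 [← hx]
    rw [← hy]
    module
  rw [SpinRep.cas_apply, hz, (smul_eq_zero.1 hp).resolve_left two_ne_zero, map_zero, map_zero,
    add_zero, add_zero]

instance : IsProbabilityMeasure (haarSU 2) :=
  ⟨Measure.haarMeasure_self (K₀ := (⊤ : TopologicalSpace.PositiveCompacts (SU 2)))⟩

instance : Measure.IsMulLeftInvariant (haarSU 2) := Measure.isMulLeftInvariant_haarMeasure _

lemma continuous_rho_SU : Continuous fun U : SU 2 => rho t (U : Matrix (Fin 2) (Fin 2) ℂ) :=
  continuous_rho.comp continuous_subtype_val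

lemma integrable_rho :
    Integrable (fun U : SU 2 => rho t (U : Matrix (Fin 2) (Fin 2) ℂ)) (haarSU 2) :=
  continuous_rho_SU.integrable_of_hasCompactSupport (HasCompactSupport.of_compactSpace _)

lemma haarMomentOp_eq : haarMomentOp 2 t =
    ∫ U : SU 2, rho t (U : Matrix (Fin 2) (Fin 2) ℂ) ∂(haarSU 2) := rfl

lemma rho_mul_haarMomentOp (U : SU 2) :
    rho t (U : Matrix (Fin 2) (Fin 2) ℂ) * haarMomentOp 2 t = haarMomentOp 2 t := by
  have h := (ContinuousLinearMap.mul ℂ (TensorSpace 2 t →L[ℂ] TensorSpace 2 t)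
    (rho t (U : Matrix (Fin 2) (Fin 2) ℂ))).integral_comp_comm (integrable_rho (t := t))
  rw [haarMomentOp_eq]
  refine h.symm.trans ?_
  have h' := integral_mul_left_eq_self (μ := haarSU 2)
    (fun V : SU 2 => rho t (V : Matrix (Fin 2) (Fin 2) ℂ)) U
  refine Eq.trans ?_ h'
  refine integral_congr_ae (Filter.Eventually.of_forall fun V => ?_)
  exact (rho_mul _ _).symm

/-- Left invariance puts the average into the invariant vectors; and for invariant u, unitarity
makes ⟨u, ρ(U)v⟩ = ⟨u, v⟩ for every U, so v minus its average is orthogonal to them. -/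
lemma haarMomentOp_eq_invProj : haarMomentOp 2 t = (spinRep t).invProj := by
  ext1 v
  refine (SpinRep.eq_invProj _ (cas_of_rho fun U => ?_) fun u hu => ?_).symm
  · exact congrArg (fun T => T v) (rho_mul_haarMomentOp (t := t) U)
  · rw [inner_sub_left, sub_eq_zero, ← inner_conj_symm, ← inner_conj_symm (haarMomentOp 2 t v)]
    congr 1
    have h := ((innerSL ℂ u) ∘L ContinuousLinearMap.apply ℂ (TensorSpace 2 t) v).integral_comp_comm
      (integrable_rho (t := t))
    rw [haarMomentOp_eq]
    refine Eq.trans ?_ h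
    have : ∀ U : SU 2, ((innerSL ℂ u) ∘L ContinuousLinearMap.apply ℂ (TensorSpace 2 t) v)
        (rho t (U : Matrix (Fin 2) (Fin 2) ℂ)) = ⟪u, v⟫_ℂ := by
      intro U
      change ⟪u, rho t (U : Matrix (Fin 2) (Fin 2) ℂ) v⟫_ℂ = _
      nth_rw 1 [← rho_of_cas hu U]
      exact inner_rho_rho (star_mul_of_mem U) u v
    simp only [this, integral_const, probReal_univ, one_smul]

end PauliRotation

end

theorem mainTheorem8 (t : ℕ) (ht : 1 ≤ t) :
    ‖PauliRotation.momentOp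
        (PauliRotation.randomRotation
          ![PauliRotation.sigmaX, PauliRotation.sigmaY, PauliRotation.sigmaZ]
          (PMF.uniformOfFintype (Fin 3))) t
      - PauliRotation.haarMomentOp 2 t‖ =
    (1 / 12 : ℝ) * (if t = 1 then 4 else if t = 2 ∨ t = 3 then 6 else 7) := by
  have h := (PauliRotation.spinRep t).norm_dev ht fun k hk =>
    PauliRotation.exists_highest_weight hk
  rw [PauliRotation.momentOp_eq_avg, PauliRotation.haarMomentOp_eq_invProj]
  change ‖(PauliRotation.spinRep t).dev‖ = _
  split_ifs at h ⊢ <;> linarith
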